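/- Let $G=(V,E)$ be a connected simple graph with $d:=\sup_{v\in V}\deg(v)<\infty$. Let $S\subset V$ be nonempty with connected induced subgraph $(S,\mathsf E_S)$, where $\mathsf E_S=\{e\in E: e\subset S\}$, and suppose that there is a subgroup $\Gamma\subset\mathrm{Aut}(G)$ with $g(S)=S$ for all $g\in\Gamma$ that acts transitively on $S$. For $p,q\in[0,1]$ let $P_{p,q}$ be the Bernoulli bond percolation measure on $\{0,1\}^E$ under which the edges are open independently, each edge of $\mathsf E_S$ with probability $q$ and each edge of $E\setminus\mathsf E_S$ with probability $p$. Write $v\leftrightarrow\infty$ for the event that the open cluster of $v$ is infinite, and let $N_\infty$ be the number of infinite open clusters. Fix $o\in V$ and put $q_c(p)=\sup\{q\in[0,1]: P_{p,q}(o\leftrightarrow\infty)=0\}$ (with $\sup\emptyset=0$) and $p_c(G)=\sup\{p\in[0,1]: P_{p,p}(o\leftrightarrow\infty)=0\}$. Let $p_c(S,\mathsf E_S)$ be the analogous threshold of homogeneous Bernoulli bond percolation on the graph $(S,\mathsf E_S)$, with any root in $S$. Suppose that $(S,\mathsf E_S)$ is amenable, i.e. for every $\varepsilon>0$ there is a finite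 nonempty $K\subset S$ such that the set $\partial_S K$ of vertices of $K$ with a neighbour in $S\setminus K$ satisfies $|\partial_S K|\le\varepsilon|K|$, and that $0<p_c(S,\mathsf E_S)<1$. Then for every $p\in(0,p_c(G))$ and every $q\in[0,1]$ with $q>\max\{q_c(d^{-2}),q_c(p)\}$, $$P_{p,q}(N_\infty=1)=1.$$ -/

import Mathlib

open MeasureTheory unitInterval

namespace Percolation

variable {V : Type*}

/-- Bond configurations of `G`: an edge `e` is open in `ω` iff `ω e = true`. -/
abbrev Config (G : SimpleGraph V) : Type _ := G.edgeSet → Bool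

/-- The spanning subgraph of `G` formed by the open edges of `ω`. -/
def openGraph (G : SimpleGraph V) (ω : Config G) : SimpleGraph V where
  Adj u v := ∃ h : G.Adj u v, ω ⟨s(u, v), h⟩ = true
  symm := ⟨by
    rintro u v ⟨h, hω⟩
    refine ⟨h.symm, ?_⟩
    have he : (⟨s(v, u), h.symm⟩ : G.edgeSet) = ⟨s(u, v), h⟩ := Subtype.ext Sym2.eq_swap
    rw [he]
    exact hω⟩
  loopless := ⟨fun u hu => G.loopless.irrefl u hu.1⟩

/-- The cluster `C(u)`: all vertices joined to `u` by an open path. -/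
def cluster (G : SimpleGraph V) (ω : Config G) (u : V) : Set V :=
  {v | (openGraph G ω).Reachable u v}

/-- The event `{u ↔ ∞}`. -/
def percolates (G : SimpleGraph V) (u : V) : Set (Config G) :=
  {ω | (cluster G ω u).Infinite}

/-- The number `N_∞` of infinite clusters. -/
noncomputable def numInfiniteClusters (G : SimpleGraph V) (ω : Config G) : ℕ∞ :=
  {C : Set V | (∃ u, C = cluster G ω u) ∧ C.Infinite}.encard

/-- Bernoulli bond percolation: edges are open independently, `e` with probability `w e`. -/
noncomputable def bernoulliPerc (G : SimpleGraph V) (w : G.edgeSet → I) :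
    Measure (Config G) :=
  Measure.infinitePi fun e => ProbabilityTheory.bernoulliMeasure true false (w e)

open Classical in
/-- The measure `P_{p,q}`: edges with both endpoints in `S` are open with probability `q`, all
other edges with probability `p`. -/
noncomputable def inhomPerc (G : SimpleGraph V) (S : Set V) (p q : I) : Measure (Config G) :=
  bernoulliPerc G fun e => if ∀ v ∈ (e : Sym2 V), v ∈ S then q else p

/-- The critical parameter of homogeneous Bernoulli bond percolation on `G`, rooted at `o`:
`sup {p | P_p(o ↔ ∞) = 0}`. -/
noncomputable def criticalProb (G : SimpleGraph V) (o : V) : I :=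
  sSup {p : I | bernoulliPerc G (fun _ => p) (percolates G o) = 0}

/-- The critical parameter function `q_c(p) = sup {q | P_{p,q}(o ↔ ∞) = 0}`. -/
noncomputable def criticalParam (G : SimpleGraph V) (S : Set V) (o : V) (p : I) : I :=
  sSup {q : I | inhomPerc G S p q (percolates G o) = 0}

/-- The interior vertex boundary of `K` in `G`. -/
def innerBoundary (G : SimpleGraph V) (K : Set V) : Set V :=
  {y | y ∈ K ∧ ∃ x, x ∉ K ∧ G.Adj x y}

/-- Amenability of a graph (of bounded degree): there are finite nonempty vertex sets `K` with
`|∂K| / |K|` arbitrarily small. -/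
def IsAmenable (G : SimpleGraph V) : Prop :=
  ∀ ε : ℝ, 0 < ε → ∃ K : Finset V, K.Nonempty ∧
    ((innerBoundary G (K : Set V)).ncard : ℝ) ≤ ε * (K.card : ℝ)

/-- `Γ|_S` is a group of automorphisms of the subgraph induced by `S` and acts transitively
on it. -/
def ActsTransitivelyOn {G : SimpleGraph V} (Γ : Subgroup (G ≃g G)) (S : Set V) : Prop :=
  (∀ g ∈ Γ, (fun v => g v) '' S = S) ∧ ∀ u ∈ S, ∀ v ∈ S, ∃ g ∈ Γ, g u = v

/-- The parameter `d⁻²`, as an element of `[0,1]`. -/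
noncomputable def invSq (d : ℕ) : I :=
  ⟨((d : ℝ) ^ 2)⁻¹, by positivity, by
    have h := Nat.cast_inv_le_one (α := ℝ) (d ^ 2)
    rwa [Nat.cast_pow] at h⟩

end Percolation

/-! The proof runs the Burton–Keane argument along Følner sets of `S` instead of `G`, which itself
may be nonamenable. This works because `p < p_c(G)`: almost surely every component of the open graph
without the edges inside `S` is finite (`ae_finite_outer_comp`). Hence an infinite cluster keeps
returning to `S`, even after finitely many vertices are deleted (`exists_mem_comp_diff`).

Both parameters are positive, so the edges of a finite ball can be opened at the cost of a positive
factor (`bernoulliPi_pos_of_openOn`). If three infinite clusters had positive probability, some ball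
centred in `S` would be an encounter ball with probability `δ > 0`, the same `δ` at every point of
`S` by transitivity. In a finite `K ⊆ S`, separated encounter points number at most twice the exits
from `K`, the points from which an open path jumps to `S \ K` with no interior vertex in `S`
(`card_encounters_le`). An exit is either near the boundary of `K`, which is rare by amenability, or
starts a long excursion outside `S`, which is rare because outer components are finite. For a good
Følner set this contradicts the density `δ` (`isEncounter_measure_zero`).

Thus there are almost surely at most two infinite clusters. Since `q > q_c(p)`, some infinite
cluster exists with positive probability, and opening a large ball merges the infinite clusters, so
uniqueness has positive probability (`hasUniqueInfinite_pos`). Uniqueness is a `Γ`-invariant event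
and `Γ` moves finite edge sets off themselves, so its probability is one
(`bernoulliPi_zero_or_one`). -/

namespace Percolation

/-! ### Bernoulli product measures: finite modification, zero-one law, monotone coupling. -/

section ProductMeasure

open ProbabilityTheory

variable {ι : Type*}

/-- The product of the Bernoulli measures with parameters `w i`. -/
noncomputable abbrev bernoulliPi (w : ι → I) : Measure (ι → Bool) :=
  Measure.infinitePi fun i => bernoulliMeasure true false (w i)

theorem indep_cylinderEvents (w : ι → I) {F T : Set ι} (h : Disjoint F T) :
    Indep (cylinderEvents (X := fun _ : ι => Bool) F) (cylinderEvents T) (bernoulliPi w) := by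
  have h1 : iIndepFun (fun i (ω : ι → Bool) => ω i) (bernoulliPi w) :=
    iIndepFun_infinitePi (X := fun _ x => x) (fun _ => measurable_id)
  exact indep_iSup_of_disjoint (fun i => (measurable_pi_apply i).comap_le) h1.iIndep h

theorem indep_inter_eq_mul (w : ι → I) {F T : Set ι} (h : Disjoint F T) {A B : Set (ι → Bool)}
    (hA : MeasurableSet[cylinderEvents F] A) (hB : MeasurableSet[cylinderEvents T] B) :
    bernoulliPi w (A ∩ B) = bernoulliPi w A * bernoulliPi w B :=
  (Indep_iff _ _ _).1 (indep_cylinderEvents w h) A B hA hB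

open Classical in
/-- Open all the coordinates in `F`. -/
noncomputable def openOn (F : Set ι) (ω : ι → Bool) : ι → Bool :=
  fun i => if i ∈ F then true else ω i

theorem measurable_openOn_compl (F : Set ι) :
    Measurable[cylinderEvents Fᶜ] (openOn F : (ι → Bool) → ι → Bool) := by
  rw [@measurable_pi_iff]
  intro i
  by_cases hi : i ∈ F
  · simp only [openOn, hi, if_true]
    exact @measurable_const _ _ _ (cylinderEvents Fᶜ) _
  · simp only [openOn, hi, if_false]
    exact measurable_cylinderEvent_apply hi

theorem measurable_openOn (F : Set ι) : Measurable (openOn F : (ι → Bool) → ι → Bool) :=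
  (measurable_openOn_compl F).mono cylinderEvents_le_pi le_rfl

/-- Finite energy. Whether `openOn F ω` lies in `E` does not depend on the coordinates in `F`, so it
is independent of the event that all of `F` is open. The latter has positive probability, and on the
intersection `openOn F ω = ω`. -/
theorem bernoulliPi_pos_of_openOn (w : ι → I) (F : Finset ι) (hF : ∀ i ∈ F, 0 < w i)
    {A E : Set (ι → Bool)} (hE : MeasurableSet E) (hA : bernoulliPi w A ≠ 0)
    (h : ∀ ω ∈ A, openOn (F : Set ι) ω ∈ E) : bernoulliPi w E ≠ 0 := by
  let O : Set (ι → Bool) := (F : Set ι).pi fun _ => {true}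
  have hO : bernoulliPi w O ≠ 0 := by
    rw [Measure.infinitePi_pi _ (fun _ _ => MeasurableSet.singleton _)]
    refine Finset.prod_ne_zero_iff.2 fun i hi => ?_
    rw [bernoulliMeasure_apply_of_mem_of_notMem _ (MeasurableSet.singleton _) rfl (by simp)]
    have := hF i hi
    simpa [← NNReal.coe_eq_zero] using this.ne'
  have hOm : MeasurableSet[cylinderEvents (F : Set ι)] O := by
    rw [show O = ⋂ i ∈ F, (fun ω : ι → Bool => ω i) ⁻¹' {true} by ext; simp [O, Set.mem_pi]]
    exact @Finset.measurableSet_biInter _ _ (cylinderEvents _) _ F fun i hi =>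
      measurable_cylinderEvent_apply (X := fun _ : ι => Bool) (Finset.mem_coe.2 hi)
        (MeasurableSet.singleton true)
  have hsub : O ∩ openOn (F : Set ι) ⁻¹' E ⊆ E := by
    rintro ω ⟨h1, h2⟩
    have : openOn (F : Set ι) ω = ω := by
      funext i
      by_cases hi : i ∈ F
      · simpa [openOn, hi] using (h1 i hi).symm
      · simp [openOn, hi]
    simpa [this] using h2
  intro h0
  have h1 := measure_mono_null hsub h0
  rw [indep_inter_eq_mul w disjoint_compl_right hOm (measurable_openOn_compl _ hE)] at h1
  rcases mul_eq_zero.1 h1 with h1 | h1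
  · exact hO h1
  · exact hA (measure_mono_null h h1)

theorem measurePreserving_reindex (w : ι → I) (e : ι ≃ ι) (he : ∀ i, w (e i) = w i) :
    MeasurePreserving (fun (ω : ι → Bool) i => ω (e i)) (bernoulliPi w) (bernoulliPi w) := by
  refine ⟨by fun_prop, ?_⟩
  rw [bernoulliPi, Measure.map_infinitePi_infinitePi_of_inj e.injective]
  simp_rw [he]

theorem measurableSet_reindex (e : ι ≃ ι) {F : Set ι} {B : Set (ι → Bool)}
    (hB : MeasurableSet[cylinderEvents F] B) :
    MeasurableSet[cylinderEvents (e '' F)] ((fun (ω : ι → Bool) i => ω (e i)) ⁻¹' B) := by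
  have : Measurable[cylinderEvents (e '' F), cylinderEvents F]
      (fun (ω : ι → Bool) i => ω (e i)) := by
    rw [measurable_iff_comap_le, cylinderEvents, MeasurableSpace.comap_iSup]
    refine iSup_le fun i => ?_
    rw [MeasurableSpace.comap_iSup]
    refine iSup_le fun hi => ?_
    rw [MeasurableSpace.comap_comp]
    exact (measurable_cylinderEvent_apply (Set.mem_image_of_mem e hi)).comap_le
  exact this hB

/-- Events invariant under weight-preserving permutations that move finite sets off themselves
have probability zero or one. -/
theorem bernoulliPi_zero_or_one (w : ι → I) (A : Set (ι → Bool)) (hA : MeasurableSet A)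
    (h : ∀ F : Finset ι, ∃ e : ι ≃ ι, (∀ i, w (e i) = w i) ∧ (∀ i ∈ F, e i ∉ F) ∧
      (fun (ω : ι → Bool) i => ω (e i)) ⁻¹' A = A) :
    bernoulliPi w A = 0 ∨ bernoulliPi w A = 1 := by
  set μ := bernoulliPi w with hμ
  -- Let the cylinder event `B` approximate `A` within `ε`. By invariance the displaced copy of `B`
  -- approximates `A` equally well, and it is independent of `B`. So `P(A)` is within `2ε` of
  -- `P(B)²`, which is within `2ε` of `P(A)²`.
  have key : ∀ ε : ℝ, 0 < ε → |μ.real A - μ.real A ^ 2| ≤ 4 * ε := by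
    intro ε hε
    have hd : μ.MeasureDense (measurableCylinders fun _ : ι => Bool) :=
      Measure.MeasureDense.of_generateFrom_isSetAlgebra_finite μ
        ⟨empty_mem_measurableCylinders _, fun _ => compl_mem_measurableCylinders,
          fun _ _ => union_mem_measurableCylinders⟩ generateFrom_measurableCylinders.symm
    obtain ⟨B, hB, hAB⟩ := hd.approx A hA (measure_ne_top _ _) ε hε
    have hBm := hd.measurable B hB
    obtain ⟨F, T, hT, rfl⟩ := (mem_measurableCylinders _).1 hB
    set B : Set (ι → Bool) := cylinder (α := fun _ : ι => Bool) F T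
    have hBF : MeasurableSet[cylinderEvents (F : Set ι)] B := by
      have : Measurable[cylinderEvents (F : Set ι)]
          (F.restrict : (ι → Bool) → (F → Bool)) := by
        rw [@measurable_pi_iff]
        exact fun i => measurable_cylinderEvent_apply (X := fun _ : ι => Bool) i.2
      exact this hT
    obtain ⟨e, he, heF, heA⟩ := h F
    set τ : (ι → Bool) → ι → Bool := fun ω i => ω (e i)
    have hτ : MeasurePreserving τ μ μ := measurePreserving_reindex w e he
    have hdis : Disjoint (F : Set ι) (e '' F) := by
      rw [Set.disjoint_right]
      rintro _ ⟨i, hi, rfl⟩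
      exact heF i hi
    have h2 : μ.real (B ∩ τ ⁻¹' B) = μ.real B ^ 2 := by
      rw [measureReal_def, indep_inter_eq_mul w hdis hBF (measurableSet_reindex e hBF),
        ← hμ, hτ.measure_preimage hBm.nullMeasurableSet, ENNReal.toReal_mul, pow_two,
        measureReal_def]
    have hε' : μ.real (symmDiff A B) ≤ ε := by
      rw [measureReal_def]
      exact ENNReal.toReal_le_of_le_ofReal hε.le hAB.le
    have h3 : μ.real (symmDiff A (τ ⁻¹' B)) ≤ ε := by
      have : symmDiff A (τ ⁻¹' B) = τ ⁻¹' (symmDiff A B) := by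
        rw [Set.preimage_symmDiff, heA]
      rw [this, measureReal_def, hτ.measure_preimage (hA.symmDiff hBm).nullMeasurableSet]
      exact hε'
    have h4 : |μ.real A - μ.real B| ≤ ε :=
      (abs_measureReal_sub_le_measureReal_symmDiff hA.nullMeasurableSet hBm.nullMeasurableSet).trans hε'
    have h5 : |μ.real A - μ.real B ^ 2| ≤ 2 * ε := by
      rw [← h2]
      refine (abs_measureReal_sub_le_measureReal_symmDiff hA.nullMeasurableSet
        (hBm.inter (hτ.measurable hBm)).nullMeasurableSet).trans ?_
      have : symmDiff A (B ∩ τ ⁻¹' B) ⊆ symmDiff A B ∪ symmDiff A (τ ⁻¹' B) := by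
        intro x hx
        simp only [Set.mem_symmDiff, Set.mem_inter_iff, Set.mem_union] at hx ⊢
        tauto
      refine (measureReal_mono this).trans ((measureReal_union_le _ _).trans (by linarith))
    have h6 : |μ.real B ^ 2 - μ.real A ^ 2| ≤ 2 * ε := by
      have : μ.real B ^ 2 - μ.real A ^ 2 = (μ.real B - μ.real A) * (μ.real B + μ.real A) := by ring
      rw [this, abs_mul, abs_sub_comm]
      have ha : μ.real A ≤ 1 := measureReal_le_one
      have hb : μ.real B ≤ 1 := measureReal_le_one
      have h0 : 0 ≤ μ.real B + μ.real A := add_nonneg measureReal_nonneg measureReal_nonneg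
      rw [abs_of_nonneg h0]
      nlinarith [abs_nonneg (μ.real A - μ.real B)]
    have := abs_sub_le (μ.real A) (μ.real B ^ 2) (μ.real A ^ 2)
    linarith
  have h0 : μ.real A - μ.real A ^ 2 = 0 := by
    by_contra hne
    have hpos := abs_pos.2 hne
    have := key (|μ.real A - μ.real A ^ 2| / 8) (by positivity)
    linarith
  have h1 : μ.real A * (1 - μ.real A) = 0 := by linarith
  rcases mul_eq_zero.1 h1 with h1 | h1
  · left
    exact (measureReal_eq_zero_iff).1 h1
  · right
    have : μ.real A = 1 := by linarith
    rw [← ENNReal.ofReal_one, ← this, ofReal_measureReal]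

open Classical in
/-- The configuration obtained from uniform labels by opening the labels below `w`. -/
noncomputable def threshold (w : ι → I) (U : ι → I) : ι → Bool := fun i => decide (U i ≤ w i)

theorem measurePreserving_threshold (w : ι → I) :
    MeasurePreserving (threshold w) (Measure.infinitePi fun _ : ι => (volume : Measure I))
      (bernoulliPi w) := by
  classical
  have hm : ∀ i, Measurable fun x : I => decide (x ≤ w i) := fun i =>
    measurable_to_bool (by
      have : (fun x : I => decide (x ≤ w i)) ⁻¹' {true} = Set.Iic (w i) := by ext; simp
      rw [this]; exact measurableSet_Iic)
  have hmeas : Measurable (threshold w) := by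
    rw [measurable_pi_iff]
    intro i
    exact (hm i).comp (measurable_pi_apply i)
  refine ⟨hmeas, ?_⟩
  have := Measure.infinitePi_map_pi (fun _ : ι => (volume : Measure I)) hm
  refine this.trans ?_
  congr 1
  funext i
  have : IsProbabilityMeasure (Measure.map (fun x => decide (x ≤ w i)) (volume : Measure I)) :=
    Measure.isProbabilityMeasure_map (hm i).aemeasurable
  have h1 : Measure.map (fun x => decide (x ≤ w i)) (volume : Measure I) {true}
      = bernoulliMeasure true false (w i) {true} := by
    rw [Measure.map_apply (hm i) (MeasurableSet.singleton _)]
    have h2 : (fun x : I => decide (x ≤ w i)) ⁻¹' {true} = Set.Iic (w i) := by ext; simp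
    rw [h2, bernoulliMeasure_apply_of_mem_of_notMem _ (MeasurableSet.singleton _) rfl (by simp),
      unitInterval.volume_Iic]
    rw [ENNReal.ofReal, ENNReal.coe_inj]
    ext
    simp [(w i).2.1]
  refine Measure.ext_of_singleton fun b => ?_
  cases b
  · have hc : ({false} : Set Bool) = {true}ᶜ := by ext x; cases x <;> simp
    rw [hc, prob_compl_eq_one_sub (MeasurableSet.singleton _),
      prob_compl_eq_one_sub (MeasurableSet.singleton _), h1]
  · exact h1

/-- Both measures are images of the same uniform labels, so an implication between the events, label
by label, compares the probabilities. -/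
theorem bernoulliPi_le_of_threshold (w w' : ι → I) {A B : Set (ι → Bool)} (hA : MeasurableSet A)
    (hB : MeasurableSet B) (h : ∀ U, threshold w U ∈ A → threshold w' U ∈ B) :
    bernoulliPi w A ≤ bernoulliPi w' B := by
  rw [← (measurePreserving_threshold w).measure_preimage hA.nullMeasurableSet,
    ← (measurePreserving_threshold w').measure_preimage hB.nullMeasurableSet]
  exact measure_mono h

end ProductMeasure

/-! ### Balls, components after deletion of vertices, and excursions from `S`. -/

section Graph

variable {V : Type*}

/-- The graph obtained from `H` by isolating the vertices of `B`. -/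
def del (H : SimpleGraph V) (B : Set V) : SimpleGraph V where
  Adj u v := H.Adj u v ∧ u ∉ B ∧ v ∉ B
  symm := ⟨fun _ _ h => ⟨h.1.symm, h.2.2, h.2.1⟩⟩
  loopless := ⟨fun u h => H.loopless.irrefl u h.1⟩

/-- The graph obtained from `H` by removing the edges with both endpoints in `S`. -/
def outer (H : SimpleGraph V) (S : Set V) : SimpleGraph V where
  Adj u v := H.Adj u v ∧ ¬ (u ∈ S ∧ v ∈ S)
  symm := ⟨fun _ _ h => ⟨h.1.symm, fun h' => h.2 h'.symm⟩⟩
  loopless := ⟨fun u h => H.loopless.irrefl u h.1⟩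

/-- The component of `u` in `H`, as a set of vertices. -/
def comp (H : SimpleGraph V) (u : V) : Set V := {v | H.Reachable u v}

/-- The closed ball of radius `n` about `x` in the graph distance. -/
def cball (G : SimpleGraph V) : ℕ → V → Set V
  | 0, x => {x}
  | n + 1, x => cball G n x ∪ {v | ∃ w ∈ cball G n x, G.Adj w v}

theorem del_le (H : SimpleGraph V) (B : Set V) : del H B ≤ H := fun _ _ h => h.1

theorem mem_cball_self (G : SimpleGraph V) (n : ℕ) (x : V) : x ∈ cball G n x := by
  induction n with
  | zero => rfl
  | succ n ih => exact Or.inl ih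

theorem cball_mono (G : SimpleGraph V) {m n : ℕ} (h : m ≤ n) (x : V) :
    cball G m x ⊆ cball G n x := by
  induction n, h using Nat.le_induction with
  | base => exact subset_rfl
  | succ n _ ih => exact ih.trans Set.subset_union_left

theorem cball_trans (G : SimpleGraph V) {m n : ℕ} {x v w : V} (hv : v ∈ cball G n x)
    (hw : w ∈ cball G m v) : w ∈ cball G (n + m) x := by
  induction m generalizing w with
  | zero => rw [show w = v from hw]; exact hv
  | succ m ih =>
    rcases hw with hw | ⟨z, hz, hzw⟩
    · exact Or.inl (ih hw)
    · exact Or.inr ⟨z, ih hz, hzw⟩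

theorem cball_symm (G : SimpleGraph V) {n : ℕ} {x v : V} (hv : v ∈ cball G n x) :
    x ∈ cball G n v := by
  induction n generalizing v with
  | zero => exact (show v = x from hv).symm
  | succ n ih =>
    rcases hv with hv | ⟨w, hw, hwv⟩
    · exact Or.inl (ih hv)
    · have h1 : w ∈ cball G 1 v := Or.inr ⟨v, rfl, hwv.symm⟩
      have := cball_trans G h1 (ih hw)
      rwa [add_comm] at this

theorem exists_mem_cball (G : SimpleGraph V) {x v : V} (h : G.Reachable x v) :
    ∃ n, v ∈ cball G n x := by
  obtain ⟨p⟩ := h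
  induction p with
  | nil => exact ⟨0, rfl⟩
  | @cons a b c hab _ ih =>
    obtain ⟨n, hn⟩ := ih
    exact ⟨1 + n, cball_trans G (Or.inr ⟨a, rfl, hab⟩) hn⟩

theorem exists_finset_subset_cball (G : SimpleGraph V) (hG : G.Connected) (x : V) (F : Finset V) :
    ∃ n, (F : Set V) ⊆ cball G n x := by
  classical
  induction F using Finset.induction_on with
  | empty => exact ⟨0, by simp⟩
  | insert a s _ ih =>
    obtain ⟨n, hn⟩ := ih
    obtain ⟨m, hm⟩ := exists_mem_cball G (hG.preconnected x a)
    refine ⟨max n m, ?_⟩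
    rw [Finset.coe_insert, Set.insert_subset_iff]
    exact ⟨cball_mono G (le_max_right _ _) x hm, hn.trans (cball_mono G (le_max_left _ _) x)⟩

theorem cball_finite (G : SimpleGraph V) (hfin : ∀ v, (G.neighborSet v).Finite) (n : ℕ) (x : V) :
    (cball G n x).Finite := by
  induction n with
  | zero => exact Set.finite_singleton x
  | succ n ih =>
    refine ih.union ((ih.biUnion fun w _ => hfin w).subset ?_)
    rintro v ⟨w, hw, hwv⟩
    exact Set.mem_biUnion hw hwv

theorem cball_ncard_le (G : SimpleGraph V) (d : ℕ) (hfin : ∀ v, (G.neighborSet v).Finite)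
    (hd : ∀ v, (G.neighborSet v).ncard ≤ d) (n : ℕ) (x : V) :
    (cball G n x).ncard ≤ (d + 1) ^ n := by
  classical
  induction n with
  | zero => simp [cball]
  | succ n ih =>
    have hf := cball_finite G hfin n x
    have h1 : {v | ∃ w ∈ cball G n x, G.Adj w v} ⊆
        ((hf.toFinset.biUnion fun w => (hfin w).toFinset : Finset V) : Set V) := by
      rintro v ⟨w, hw, hwv⟩
      simp only [Finset.coe_biUnion, Set.mem_iUnion]
      exact ⟨w, by simpa using hw, by simpa using hwv⟩
    have h2 : ({v | ∃ w ∈ cball G n x, G.Adj w v} : Set V).ncard ≤ (cball G n x).ncard * d := by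
      refine (Set.ncard_le_ncard h1 (Finset.finite_toSet _)).trans ?_
      rw [Set.ncard_coe_finset]
      refine (Finset.card_biUnion_le_card_mul _ _ d fun w _ => ?_).trans ?_
      · rw [← Set.ncard_eq_toFinset_card _ (hfin w)]; exact hd w
      · rw [← Set.ncard_eq_toFinset_card _ hf]
    calc (cball G (n + 1) x).ncard
        ≤ (cball G n x).ncard + ({v | ∃ w ∈ cball G n x, G.Adj w v} : Set V).ncard :=
          Set.ncard_union_le _ _
      _ ≤ (cball G n x).ncard + (cball G n x).ncard * d := by gcongr
      _ = (cball G n x).ncard * (d + 1) := by ring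
      _ ≤ (d + 1) ^ (n + 1) := by rw [pow_succ]; gcongr

theorem mem_cball_map_iff {G : SimpleGraph V} (φ : V ≃ V) (hφ : ∀ u v, G.Adj u v ↔ G.Adj (φ u) (φ v))
    (n : ℕ) (x v : V) : φ v ∈ cball G n (φ x) ↔ v ∈ cball G n x := by
  induction n generalizing v with
  | zero => exact φ.injective.eq_iff
  | succ n ih =>
    simp only [cball, Set.mem_union, ih, Set.mem_ofPred_eq]
    refine or_congr_right ⟨?_, ?_⟩
    · rintro ⟨w, hw, hwv⟩
      obtain ⟨w, rfl⟩ := φ.surjective w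
      exact ⟨w, (ih w).1 hw, (hφ _ _).2 hwv⟩
    · rintro ⟨w, hw, hwv⟩
      exact ⟨φ w, (ih w).2 hw, (hφ _ _).1 hwv⟩

theorem reachable_of_mem_cball {G H : SimpleGraph V} {n : ℕ} {x : V}
    (h : ∀ u ∈ cball G n x, ∀ v ∈ cball G n x, G.Adj u v → H.Adj u v) {v : V}
    (hv : v ∈ cball G n x) : H.Reachable x v := by
  have key : ∀ m ≤ n, ∀ v ∈ cball G m x, H.Reachable x v := by
    intro m
    induction m with
    | zero => rintro - v rfl; rfl
    | succ m ih =>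
      rintro hm v (hv | ⟨w, hw, hwv⟩)
      · exact ih (by omega) v hv
      · exact (ih (by omega) w hw).trans (h w (cball_mono G (by omega) x hw) v
          (cball_mono G hm x (Or.inr ⟨w, hw, hwv⟩)) hwv).reachable
  exact key n le_rfl v hv

theorem countable_of_connected (G : SimpleGraph V) (hG : G.Connected)
    (hfin : ∀ v, (G.neighborSet v).Finite) : Countable V := by
  obtain ⟨x⟩ := hG.nonempty
  have : (Set.univ : Set V) = ⋃ n, cball G n x := by
    ext v
    simpa using exists_mem_cball G (hG.preconnected x v)
  rw [← Set.countable_univ_iff, this]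
  exact Set.countable_iUnion fun n => (cball_finite G hfin n x).countable

theorem reachable_map_iff {H H' : SimpleGraph V} (φ : V ≃ V)
    (h : ∀ u v, H'.Adj u v ↔ H.Adj (φ u) (φ v)) (u v : V) :
    H.Reachable (φ u) (φ v) ↔ H'.Reachable u v :=
  SimpleGraph.Iso.reachable_iff (φ := (⟨φ, fun {a b} => (h a b).symm⟩ : H' ≃g H))

theorem infinite_comp_map_iff {H H' : SimpleGraph V} (φ : V ≃ V)
    (h : ∀ u v, H'.Adj u v ↔ H.Adj (φ u) (φ v)) (u : V) :
    (comp H (φ u)).Infinite ↔ (comp H' u).Infinite := by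
  have : comp H (φ u) = φ '' comp H' u := by
    ext v
    obtain ⟨v, rfl⟩ := φ.surjective v
    simpa [comp] using reachable_map_iff φ h u v
  rw [this, Set.infinite_image_iff φ.injective.injOn]

/-- A path hitting `B` has a last vertex before its first visit to `B`. -/
theorem exists_first_hit {H : SimpleGraph V} {B : Set V} {u v : V} (h : H.Reachable u v)
    (hu : u ∉ B) (hv : v ∈ B) :
    ∃ a, a ∉ B ∧ (del H B).Reachable u a ∧ ∃ b ∈ B, H.Adj a b := by
  obtain ⟨p⟩ := h
  induction p with
  | nil => exact absurd hv hu
  | @cons u w v huw _ ih =>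
    by_cases hw : w ∈ B
    · exact ⟨u, hu, .rfl, w, hw, huw⟩
    · obtain ⟨a, ha, hwa, hb⟩ := ih hw hv
      exact ⟨a, ha, (SimpleGraph.Adj.reachable (G := del H B) ⟨huw, hu, hw⟩).trans hwa, hb⟩

theorem reachable_mono_on {H H' : SimpleGraph V} {u v : V}
    (hle : ∀ a b, H.Reachable u a → H.Adj a b → H'.Adj a b) (h : H.Reachable u v) :
    H'.Reachable u v := by
  obtain ⟨p⟩ := h
  induction p with
  | nil => rfl
  | @cons u w v huw _ ih =>
    exact (hle u w .rfl huw).reachable.trans (ih fun a b ha => hle a b (huw.reachable.trans ha))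

theorem reachable_del_of_avoid {H H' : SimpleGraph V} (hle : H' ≤ H) {B : Set V} {u v : V}
    (h : H'.Reachable u v) (hB : ∀ w ∈ B, ¬ H'.Reachable u w) : (del H B).Reachable u v :=
  reachable_mono_on (fun a b ha hab => ⟨hle hab, fun h => hB a h ha,
    fun h => hB b h (ha.trans hab.reachable)⟩) h

/-- Removing a finite set `F` from an infinite component that meets `F` leaves an infinite
component with a vertex adjacent to `F`. -/
theorem exists_infinite_del_comp {H : SimpleGraph V} (hfin : ∀ v, (H.neighborSet v).Finite)
    {F : Set V} (hF : F.Finite) {u f : V} (hinf : (comp H u).Infinite) (hf : f ∈ F)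
    (huf : H.Reachable u f) :
    ∃ v, v ∉ F ∧ (∃ b ∈ F, H.Adj b v) ∧ H.Reachable u v ∧ (comp (del H F) v).Infinite := by
  by_contra hcon
  push Not at hcon
  have h1 : (⋃ b ∈ F, ⋃ v ∈ H.neighborSet b ∩ {v | v ∉ F ∧ H.Reachable u v},
      comp (del H F) v).Finite := by
    refine hF.biUnion fun b hb => ((hfin b).inter_of_left _).biUnion fun v hv => ?_
    exact hcon v hv.2.1 ⟨b, hb, hv.1⟩ hv.2.2
  refine hinf ((hF.union h1).subset fun w hw => ?_)
  by_cases hwF : w ∈ F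
  · exact Or.inl hwF
  · obtain ⟨a, ha, hwa, b, hb, hab⟩ :=
      exists_first_hit ((SimpleGraph.Reachable.symm hw).trans huf) hwF hf
    refine Or.inr (Set.mem_biUnion hb (Set.mem_biUnion (x := a) ⟨hab.symm, ha, ?_⟩ hwa.symm))
    exact SimpleGraph.Reachable.trans hw (hwa.mono (del_le _ _))

/-- An infinite component, with finitely many vertices removed, still has an infinite component. -/
theorem exists_infinite_del_comp' {H : SimpleGraph V} (hfin : ∀ v, (H.neighborSet v).Finite)
    {F : Set V} (hF : F.Finite) {u : V} (hinf : (comp H u).Infinite) :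
    ∃ v, H.Reachable u v ∧ (comp (del H F) v).Infinite := by
  by_cases h : ∃ f ∈ F, H.Reachable u f
  · obtain ⟨f, hf, huf⟩ := h
    obtain ⟨v, -, -, h1, h2⟩ := exists_infinite_del_comp hfin hF hinf hf huf
    exact ⟨v, h1, h2⟩
  · push Not at h
    refine ⟨u, .rfl, hinf.mono fun v hv => ?_⟩
    exact reachable_del_of_avoid le_rfl hv h

/-- If all components of `outer H S` are finite, an infinite component of `del H B` leaves every
finite set within `S`. -/
theorem exists_mem_comp_diff {H : SimpleGraph V} (hfin : ∀ v, (H.neighborSet v).Finite)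
    {S K B : Set V} (hK : K.Finite) (hout : ∀ v, (comp (outer H S) v).Finite) {u : V}
    (hinf : (comp (del H B) u).Infinite) : ∃ s ∈ S, s ∉ K ∧ (del H B).Reachable u s := by
  by_contra hcon
  push Not at hcon
  have hfin' : ∀ v, ((del H B).neighborSet v).Finite := fun v =>
    (hfin v).subset fun w hw => hw.1
  obtain ⟨v, huv, hv⟩ := exists_infinite_del_comp' hfin' hK hinf
  -- Beyond `K` this component has no vertex of `S`, so all its edges survive in `outer H S`, whose
  -- components are finite.
  refine hv ((hout v).subset fun w hw => ?_)
  refine reachable_mono_on (H := del (del H B) K) (fun a b ha hab => ⟨hab.1.1, fun hS => ?_⟩) hw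
  exact hcon a hS.1 hab.2.1 (huv.trans (ha.mono (del_le _ _)))

/-- `z` can be reached from `y` by a path of `H` without interior vertices in `S`. -/
def Excursion (H : SimpleGraph V) (S : Set V) (y z : V) : Prop :=
  H.Adj y z ∨ ∃ a b, a ∉ S ∧ b ∉ S ∧ H.Adj y a ∧ (del H S).Reachable a b ∧ H.Adj b z

theorem del_mono {H H' : SimpleGraph V} (h : H ≤ H') (B : Set V) : del H B ≤ del H' B :=
  fun _ _ huv => ⟨h huv.1, huv.2⟩

theorem del_le_outer (H : SimpleGraph V) (S : Set V) : del H S ≤ outer H S :=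
  fun _ _ huv => ⟨huv.1, fun h => huv.2.1 h.1⟩

theorem Excursion.mono {H H' : SimpleGraph V} (h : H ≤ H') {S : Set V} {y z : V}
    (hyz : Excursion H S y z) : Excursion H' S y z := by
  rcases hyz with h1 | ⟨a, b, ha, hb, h1, h2, h3⟩
  · exact Or.inl (h h1)
  · exact Or.inr ⟨a, b, ha, hb, h h1, h2.mono (del_mono h S), h h3⟩

/-- A walk from `K` to `S \ K` has a stretch that leaves `K` and next meets `S` outside `K`. The
induction on the walk carries two further states for the current vertex: it lies in `S \ K`, or it
lies off `S` and reaches `S \ K` without meeting `S` earlier. -/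
theorem exists_excursion {H : SimpleGraph V} {S K : Set V} (hKS : K ⊆ S) {x s : V}
    (hx : x ∈ K) (hs : s ∈ S) (hsK : s ∉ K) (h : H.Reachable x s) :
    ∃ y ∈ K, ∃ z ∈ S, z ∉ K ∧ H.Reachable x y ∧ Excursion H S y z := by
  obtain ⟨p⟩ := h
  have key : (∃ y ∈ K, ∃ z ∈ S, z ∉ K ∧ H.Reachable x y ∧ Excursion H S y z) ∨
      (x ∈ S ∧ x ∉ K) ∨ (x ∉ S ∧ ∃ b, b ∉ S ∧ ∃ z ∈ S, z ∉ K ∧ (del H S).Reachable x b ∧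
        H.Adj b z) := by
    clear hx
    induction p with
    | nil => exact Or.inr (Or.inl ⟨hs, hsK⟩)
    | @cons v w s hvw _ ih =>
      rcases ih hs hsK with ⟨y, hy, z, hz, hzK, h1, h2⟩ | ⟨h1, h2⟩ |
        ⟨h1, b, hb, z, hz, hzK, h2, h3⟩
      · exact Or.inl ⟨y, hy, z, hz, hzK, hvw.reachable.trans h1, h2⟩
      · by_cases hvK : v ∈ K
        · exact Or.inl ⟨v, hvK, w, h1, h2, .rfl, Or.inl hvw⟩
        · by_cases hvS : v ∈ S
          · exact Or.inr (Or.inl ⟨hvS, hvK⟩)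
          · exact Or.inr (Or.inr ⟨hvS, v, hvS, w, h1, h2, .rfl, hvw⟩)
      · by_cases hvK : v ∈ K
        · exact Or.inl ⟨v, hvK, z, hz, hzK, .rfl, Or.inr ⟨w, b, h1, hb, hvw, h2, h3⟩⟩
        · by_cases hvS : v ∈ S
          · exact Or.inr (Or.inl ⟨hvS, hvK⟩)
          · exact Or.inr (Or.inr ⟨hvS, b, hb, z, hz, hzK,
              (SimpleGraph.Adj.reachable (G := del H S) ⟨hvw, hvS, h1⟩).trans h2, h3⟩)
  rcases key with h | h | h
  · exact h
  · exact absurd hx h.2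
  · exact absurd (hKS hx) h.1

/-- Except for a single direct edge, every edge of an excursion has an endpoint off `S`. This lets
the excursion be controlled by the finite outer components. -/
theorem Excursion.outer_reachable {H : SimpleGraph V} {S : Set V} {y z : V}
    (h : Excursion H S y z) : H.Adj y z ∨ (outer H S).Reachable y z := by
  rcases h with h | ⟨a, b, ha, hb, h1, h2, h3⟩
  · exact Or.inl h
  · refine Or.inr ?_
    have e1 : (outer H S).Adj y a := ⟨h1, fun h => ha h.2⟩
    have e2 : (outer H S).Adj b z := ⟨h3, fun h => hb h.1⟩
    exact e1.reachable.trans ((h2.mono (del_le_outer H S)).trans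
      e2.reachable)

end Graph

/-! ### Counting disjoint sets that separate three components. -/

section Separating

variable {V : Type*}

/-- If the disjoint connected sets `B`, `B'` separate, and a component of `del H B` contains `B'`
but not `r`, then it contains all components of `del H B'` adjacent to `B'` that do not contain
`r`. -/
theorem reachable_del_of_nested {H : SimpleGraph V} {B B' : Set V} {x x' r u w : V}
    (hdis : Disjoint B B')
    (hB : ∀ v ∈ B, (del H B').Reachable x v) (hB' : ∀ v ∈ B', (del H B).Reachable x' v)
    (hx : x ∈ B) (hr : H.Reachable r x) (hru : ¬ (del H B).Reachable u r)
    (hux' : (del H B).Reachable u x')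
    {u' : V} (hadj : ∃ b ∈ B', H.Adj b u')
    (hru' : ¬ (del H B').Reachable u' r) (hw : (del H B').Reachable u' w) :
    (del H B).Reachable u w := by
  -- The component of `r` in `del H B` misses `B'`, since `B'` lies in the component of `u`. So the
  -- path from `r` up to `B` survives the deletion of `B'`.
  have hrx : (del H B').Reachable r x := by
    by_cases hrB : r ∈ B
    · exact (hB r hrB).symm
    · obtain ⟨a, ha, hra, b, hb, hab⟩ := exists_first_hit hr hrB hx
      have havoid : ∀ z ∈ B', ¬ (del H B).Reachable r z := fun z hz h =>
        hru (hux'.trans ((hB' z hz).trans h.symm))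
      have h1 : (del H B').Reachable r a := reachable_del_of_avoid (del_le _ _) hra havoid
      have h2 : (del H B').Adj a b :=
        ⟨hab, fun h => havoid a h hra, Set.disjoint_left.1 hdis hb⟩
      exact h1.trans (h2.reachable.trans (hB b hb).symm)
  -- Reaching `B` would mean reaching `r` through `x`.
  have havoid : ∀ z ∈ B, ¬ (del H B').Reachable u' z := fun z hz h =>
    hru' (h.trans ((hB z hz).symm.trans hrx.symm))
  obtain ⟨b, hb, hbu⟩ := hadj
  have h1 : (del H B).Adj b u' :=
    ⟨hbu, Set.disjoint_right.1 hdis hb, fun h => havoid u' h .rfl⟩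
  exact hux'.trans ((hB' b hb).trans (h1.reachable.trans
    (reachable_del_of_avoid (del_le _ _) hw havoid)))

/-- Components of `del H B` and `del H B'` that meet are nested. -/
theorem reachable_del_or {H : SimpleGraph V} {B B' : Set V} {x x' u u' l : V}
    (hdis : Disjoint B B')
    (hB : ∀ v ∈ B, (del H B').Reachable x v) (hB' : ∀ v ∈ B', (del H B).Reachable x' v)
    (hadj : ∃ b ∈ B, H.Adj b u)
    (hl : (del H B).Reachable u l) (hl' : (del H B').Reachable u' l) :
    (del H B).Reachable u x' ∨ (del H B').Reachable u' x := by
  by_contra hcon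
  push Not at hcon
  have havoid : ∀ z ∈ B', ¬ (del H B).Reachable u z := fun z hz h =>
    hcon.1 (h.trans (hB' z hz).symm)
  -- The component of `u` avoids `B'`, so in `del H B'` it stays connected and is joined to `B` by
  -- the edge at `u`. Through `l` this brings `u'` to `x`.
  have h1 : (del H B').Reachable u l := reachable_del_of_avoid (del_le _ _) hl havoid
  obtain ⟨b, hb, hbu⟩ := hadj
  have h2 : (del H B').Adj u b :=
    ⟨hbu.symm, fun h => havoid u h .rfl, Set.disjoint_left.1 hdis hb⟩
  exact hcon.2 (hl'.trans (h1.symm.trans (h2.reachable.trans (hB b hb).symm)))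

/-- Disjoint connected sets, each of which has three adjacent components of its complement that
meet `L`, are at most as many as the elements of `L`. -/
theorem card_le_of_separating [LinearOrder V] {ι : Type*} (H : SimpleGraph V) (L : Finset V)
    (A : Finset ι) (B : ι → Set V) (x : ι → V) (c : ι → Fin 3 → V)
    (hdis : ∀ i ∈ A, ∀ j ∈ A, i ≠ j → Disjoint (B i) (B j))
    (hx : ∀ i ∈ A, x i ∈ B i)
    (hconn : ∀ i ∈ A, ∀ j ∈ A, i ≠ j → ∀ v ∈ B i, (del H (B j)).Reachable (x i) v)
    (hreach : ∀ i ∈ A, ∀ v ∈ B i, H.Reachable (x i) v)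
    (hc : ∀ i ∈ A, ∀ a, ∃ b ∈ B i, H.Adj b (c i a))
    (hsep : ∀ i ∈ A, ∀ a b, a ≠ b → ¬ (del H (B i)).Reachable (c i a) (c i b))
    (hL : ∀ i ∈ A, ∀ a, ∃ y ∈ L, (del H (B i)).Reachable (c i a) y) :
    A.card ≤ L.card := by
  classical
  have hxc : ∀ i ∈ A, ∀ a, H.Reachable (x i) (c i a) := by
    intro i hi a
    obtain ⟨b, hb, hba⟩ := hc i hi a
    exact (hreach i hi b hb).trans hba.reachable
  -- the smallest element of `L` in the component of `u` in `K`
  let T : SimpleGraph V → V → Finset V := fun K u => L.filter fun y => K.Reachable u y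
  let m : SimpleGraph V → V → V := fun K u => if h : (T K u).Nonempty then (T K u).min' h else u
  have hm : ∀ K u, (∃ y ∈ L, K.Reachable u y) →
      m K u ∈ L ∧ K.Reachable u (m K u) ∧ ∀ y ∈ L, K.Reachable u y → m K u ≤ y := by
    rintro K u ⟨y, hy, huy⟩
    have hne : (T K u).Nonempty := ⟨y, Finset.mem_filter.2 ⟨hy, huy⟩⟩
    have h1 : m K u = (T K u).min' hne := dif_pos hne
    have h2 := Finset.mem_filter.1 (Finset.min'_mem _ hne)
    rw [h1]
    exact ⟨h2.1, h2.2, fun z hz huz => Finset.min'_le _ _ (Finset.mem_filter.2 ⟨hz, huz⟩)⟩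
  have hroot : ∀ i ∈ A, H.Reachable (m H (x i)) (x i) := by
    intro i hi
    obtain ⟨y, hy, h⟩ := hL i hi 0
    exact (hm H (x i) ⟨y, hy, (hxc i hi 0).trans (h.mono (del_le _ _))⟩).2.1.symm
  have hroot_eq : ∀ i ∈ A, ∀ j, H.Reachable (x i) (x j) → m H (x i) = m H (x j) := by
    intro i hi j hij
    obtain ⟨y, hy, h⟩ := hL i hi 0
    have hy' := (hxc i hi 0).trans (h.mono (del_le _ _))
    have h1 := hm H (x i) ⟨y, hy, hy'⟩
    have h2 := hm H (x j) ⟨y, hy, hij.symm.trans hy'⟩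
    exact le_antisymm (h1.2.2 _ h2.1 (hij.trans h2.2.1)) (h2.2.2 _ h1.1 (hij.symm.trans h1.2.1))
  -- The minimum of `L` in a component of `H` serves as its root. At most one of the three
  -- components at `B i` contains the root, and two others are ordered by their minima in `L`, with
  -- `b` the larger.
  have hchild : ∀ i ∈ A, ∃ a b, m (del H (B i)) (c i a) < m (del H (B i)) (c i b) ∧
      ¬ (del H (B i)).Reachable (c i a) (m H (x i)) ∧
      ¬ (del H (B i)).Reachable (c i b) (m H (x i)) := by
    intro i hi
    have h1 : ∃ a b : Fin 3, a ≠ b ∧ ¬ (del H (B i)).Reachable (c i a) (m H (x i)) ∧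
        ¬ (del H (B i)).Reachable (c i b) (m H (x i)) := by
      by_contra hcon
      push Not at hcon
      have h2 : ∀ a b : Fin 3, a ≠ b → (del H (B i)).Reachable (c i a) (m H (x i)) →
          ¬ (del H (B i)).Reachable (c i b) (m H (x i)) := fun a b hab h h' =>
        hsep i hi a b hab (h.trans h'.symm)
      have h01 := hcon 0 1 (by decide)
      have h02 := hcon 0 2 (by decide)
      have h12 := hcon 1 2 (by decide)
      have g01 := h2 0 1 (by decide)
      have g02 := h2 0 2 (by decide)
      have g12 := h2 1 2 (by decide)
      tauto
    obtain ⟨a, b, hab, ha, hb⟩ := h1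
    have hne : m (del H (B i)) (c i a) ≠ m (del H (B i)) (c i b) := by
      intro h
      refine hsep i hi a b hab ((hm _ _ (hL i hi a)).2.1.trans ?_)
      rw [h]
      exact (hm _ _ (hL i hi b)).2.1.symm
    rcases lt_or_gt_of_ne hne with h | h
    · exact ⟨a, b, h, ha, hb⟩
    · exact ⟨b, a, h, hb, ha⟩
  have : ∃ a b : ι → Fin 3, ∀ i ∈ A,
      m (del H (B i)) (c i (a i)) < m (del H (B i)) (c i (b i)) ∧
      ¬ (del H (B i)).Reachable (c i (a i)) (m H (x i)) ∧
      ¬ (del H (B i)).Reachable (c i (b i)) (m H (x i)) := by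
    choose! a b h using hchild
    exact ⟨a, b, h⟩
  obtain ⟨a, b, hab⟩ := this
  -- Each index is charged to the larger of its two minima. If two indices shared this point, their
  -- `b`-components would meet and `reachable_del_or` would nest them.
  refine Finset.card_le_card_of_injOn (fun i => m (del H (B i)) (c i (b i)))
    (fun i hi => (hm _ _ (hL i hi _)).1) ?_
  -- one of the two nested configurations is impossible
  have key : ∀ i ∈ A, ∀ j ∈ A, i ≠ j →
      m (del H (B i)) (c i (b i)) = m (del H (B j)) (c j (b j)) →
      ¬ (del H (B i)).Reachable (c i (b i)) (x j) := by
    intro i hi j hj hij heq hreach'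
    have hxx : m H (x i) = m H (x j) :=
      hroot_eq i hi j ((hxc i hi _).trans (hreach'.mono (del_le _ _)))
    have hmem := hm _ _ (hL j hj (a j))
    -- The `b`-component of `i` swallows the `a`-component of `j`, so the common minimum is at most
    -- the `a`-minimum of `j`. But it is also the `b`-minimum of `j`, which is strictly larger.
    have h1 := reachable_del_of_nested (hdis i hi j hj hij) (hconn i hi j hj hij)
      (hconn j hj i hi hij.symm) (hx i hi) (hroot i hi) (hab i hi).2.2 hreach'
      (hc j hj (a j)) (hxx ▸ (hab j hj).2.1) hmem.2.1
    have h2 := (hm _ _ (hL i hi (b i))).2.2 _ hmem.1 h1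
    rw [heq] at h2
    exact absurd (hab j hj).1 h2.not_gt
  intro i hi j hj heq
  by_contra hij
  have heq' : m (del H (B i)) (c i (b i)) = m (del H (B j)) (c j (b j)) := heq
  have hi' := (hm _ _ (hL i hi (b i))).2.1
  have hj' := (hm _ _ (hL j hj (b j))).2.1
  rw [← heq'] at hj'
  rcases reachable_del_or (hdis i hi j hj hij) (hconn i hi j hj hij)
    (hconn j hj i hi (Ne.symm hij)) (hc i hi (b i)) hi' hj' with h | h
  · exact key i hi j hj hij heq' h
  · exact key j hj i hi (Ne.symm hij) heq'.symm h

end Separating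

/-! ### Measurability, automorphism invariance and local modification of percolation events. -/

section Events

variable {V : Type*}

theorem measurable_mem_cball {Ω : Type*} [MeasurableSpace Ω] [Countable V] {K : Ω → SimpleGraph V}
    (hK : ∀ u v, Measurable fun ω => (K ω).Adj u v) (n : ℕ) (x v : V) :
    Measurable fun ω => v ∈ cball (K ω) n x := by
  induction n generalizing v with
  | zero => exact measurable_const
  | succ n ih => exact (ih v).or (Measurable.exists fun w => (ih w).and (hK w v))

theorem measurable_reachable {Ω : Type*} [MeasurableSpace Ω] [Countable V] {K : Ω → SimpleGraph V}
    (hK : ∀ u v, Measurable fun ω => (K ω).Adj u v) (u v : V) :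
    Measurable fun ω => (K ω).Reachable u v := by
  have : (fun ω => (K ω).Reachable u v) = fun ω => ∃ n, v ∈ cball (K ω) n u := by
    funext ω
    exact propext ⟨exists_mem_cball _, fun ⟨n, hn⟩ =>
      reachable_of_mem_cball (fun _ _ _ _ h => h) hn⟩
  rw [this]
  exact Measurable.exists fun n => measurable_mem_cball hK n u v

/-- Over a countable vertex set this form uses only countable quantifiers, hence gives
measurability. -/
theorem infinite_comp_iff {H : SimpleGraph V} {u : V} :
    (comp H u).Infinite ↔ ∀ F : Finset V, ∃ v, v ∉ F ∧ H.Reachable u v := by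
  refine ⟨fun h F => ?_, fun h hfin => ?_⟩
  · obtain ⟨v, hv, hvF⟩ := h.exists_notMem_finset F
    exact ⟨v, hvF, hv⟩
  · obtain ⟨v, hv, huv⟩ := h hfin.toFinset
    exact hv (hfin.mem_toFinset.2 huv)

theorem measurable_infinite_comp {Ω : Type*} [MeasurableSpace Ω] [Countable V]
    {K : Ω → SimpleGraph V} (hK : ∀ u v, Measurable fun ω => (K ω).Adj u v) (u : V) :
    Measurable fun ω => (comp (K ω) u).Infinite := by
  simp_rw [infinite_comp_iff]
  exact Measurable.forall fun F => Measurable.exists fun v =>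
    measurable_const.and (measurable_reachable hK u v)

theorem measurable_openGraph_adj (G : SimpleGraph V) (u v : V) :
    Measurable fun ω : Config G => (openGraph G ω).Adj u v := by
  by_cases h : G.Adj u v
  · have : (fun ω : Config G => (openGraph G ω).Adj u v) = fun ω => ω ⟨s(u, v), h⟩ = true := by
      funext ω
      exact propext ⟨fun h => h.2, fun h' => ⟨h, h'⟩⟩
    rw [this]
    have hm : Measurable fun ω : Config G => ω ⟨s(u, v), h⟩ := by fun_prop
    exact measurableSet_setOfPred.1 (hm (MeasurableSet.singleton true))
  · have : (fun ω : Config G => (openGraph G ω).Adj u v) = fun _ => False := by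
      funext ω
      exact propext ⟨fun h' => h h'.1, False.elim⟩
    rw [this]
    exact measurable_const

theorem measurable_del_adj (G : SimpleGraph V) (B : Set V) (u v : V) :
    Measurable fun ω : Config G => (del (openGraph G ω) B).Adj u v :=
  (measurable_openGraph_adj G u v).and measurable_const

theorem measurable_outer_adj (G : SimpleGraph V) (S : Set V) (u v : V) :
    Measurable fun ω : Config G => (outer (openGraph G ω) S).Adj u v :=
  (measurable_openGraph_adj G u v).and measurable_const

/-- All edges of `G` in the ball of radius `R` about `x` are in `H`, and removing the ball from
`H` leaves at least three infinite components adjacent to it. -/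
def IsEncounter (G H : SimpleGraph V) (R : ℕ) (x : V) : Prop :=
  (∀ u ∈ cball G R x, ∀ v ∈ cball G R x, G.Adj u v → H.Adj u v) ∧
  ∃ c : Fin 3 → V, (∀ i, (∃ b ∈ cball G R x, H.Adj b (c i)) ∧
      (comp (del H (cball G R x)) (c i)).Infinite) ∧
    ∀ i j, i ≠ j → ¬ (del H (cball G R x)).Reachable (c i) (c j)

/-- `H` has exactly one infinite component. -/
def HasUniqueInfinite (H : SimpleGraph V) : Prop :=
  (∃ u, (comp H u).Infinite) ∧
    ∀ u v, (comp H u).Infinite → (comp H v).Infinite → H.Reachable u v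

/-- `H` has at least three infinite components. -/
def HasThreeInfinite (H : SimpleGraph V) : Prop :=
  ∃ c : Fin 3 → V, (∀ i, (comp H (c i)).Infinite) ∧ ∀ i j, i ≠ j → ¬ H.Reachable (c i) (c j)

theorem measurableSet_isEncounter [Countable V] (G : SimpleGraph V) (R : ℕ) (x : V) :
    MeasurableSet {ω : Config G | IsEncounter G (openGraph G ω) R x} := by
  refine measurableSet_setOfPred.2 (Measurable.and ?_ ?_)
  · exact Measurable.forall fun u => Measurable.imp measurable_const <| Measurable.forall fun v =>
      Measurable.imp measurable_const <| Measurable.imp measurable_const <|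
        measurable_openGraph_adj G u v
  · refine Measurable.exists fun c => Measurable.and (Measurable.forall fun i =>
      Measurable.and ?_ ?_) ?_
    · exact Measurable.exists fun b => Measurable.and measurable_const
        (measurable_openGraph_adj G _ _)
    · exact measurable_infinite_comp (measurable_del_adj G _) _
    · exact Measurable.forall fun i => Measurable.forall fun j => Measurable.imp measurable_const
        (measurable_reachable (measurable_del_adj G _) _ _).not

theorem measurableSet_hasUniqueInfinite [Countable V] (G : SimpleGraph V) :
    MeasurableSet {ω : Config G | HasUniqueInfinite (openGraph G ω)} := by
  have h := measurable_infinite_comp (measurable_openGraph_adj G)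
  refine measurableSet_setOfPred.2 (Measurable.and (Measurable.exists h) ?_)
  exact Measurable.forall fun u => Measurable.forall fun v => Measurable.imp (h u) <|
    Measurable.imp (h v) (measurable_reachable (measurable_openGraph_adj G) u v)

theorem numInfiniteClusters_eq_one {G : SimpleGraph V} {ω : Config G}
    (h : HasUniqueInfinite (openGraph G ω)) : numInfiniteClusters G ω = 1 := by
  obtain ⟨⟨u, hu⟩, huniq⟩ := h
  refine Set.encard_eq_one.2 ⟨cluster G ω u, Set.eq_singleton_iff_unique_mem.2
    ⟨⟨⟨u, rfl⟩, hu⟩, ?_⟩⟩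
  rintro _ ⟨⟨v, rfl⟩, hv⟩
  have huv := huniq u v hu hv
  ext z
  exact ⟨fun hz => huv.trans hz, fun hz => huv.symm.trans hz⟩

/-! ### Automorphisms -/

theorem openGraph_mapEdgeSet_adj {G : SimpleGraph V} (g : G ≃g G) (ω : Config G) (u v : V) :
    (openGraph G fun e => ω (g.mapEdgeSet e)).Adj u v ↔ (openGraph G ω).Adj (g u) (g v) := by
  constructor
  · rintro ⟨h, h'⟩
    exact ⟨g.map_adj_iff.2 h, h'⟩
  · rintro ⟨h, h'⟩
    exact ⟨g.map_adj_iff.1 h, h'⟩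

theorem hasUniqueInfinite_map_iff {H H' : SimpleGraph V} (φ : V ≃ V)
    (h : ∀ u v, H'.Adj u v ↔ H.Adj (φ u) (φ v)) :
    HasUniqueInfinite H' ↔ HasUniqueInfinite H := by
  have hi := fun u => (infinite_comp_map_iff φ h u).symm
  exact and_congr (φ.exists_congr hi) (φ.forall_congr fun u => φ.forall_congr fun v =>
    imp_congr (hi u) (imp_congr (hi v) (reachable_map_iff φ h u v).symm))

theorem isEncounter_map_iff {G H H' : SimpleGraph V} (φ : V ≃ V)
    (hG : ∀ u v, G.Adj u v ↔ G.Adj (φ u) (φ v))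
    (h : ∀ u v, H'.Adj u v ↔ H.Adj (φ u) (φ v)) (R : ℕ) (x : V) :
    IsEncounter G H' R x ↔ IsEncounter G H R (φ x) := by
  have hd : ∀ u v, (del H' (cball G R x)).Adj u v ↔ (del H (cball G R (φ x))).Adj (φ u) (φ v) := by
    intro u v
    simp only [del, mem_cball_map_iff φ hG, h]
  have hB := fun v => (mem_cball_map_iff φ hG R x v).symm
  refine and_congr ?_ ((Equiv.piCongrRight fun _ : Fin 3 => φ).exists_congr fun c =>
    and_congr (forall_congr' fun i => and_congr ?_ (infinite_comp_map_iff φ hd (c i)).symm) ?_)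
  · exact φ.forall_congr fun u => imp_congr (hB u) (φ.forall_congr fun v =>
      imp_congr (hB v) (imp_congr (hG u v) (h u v)))
  · exact φ.exists_congr fun b => and_congr (hB b) (h b (c i))
  · exact forall_congr' fun i => forall_congr' fun j => imp_congr_right fun _ =>
      not_congr (reachable_map_iff φ hd (c i) (c j)).symm

/-! ### Opening the edges of a finite set -/

open Classical in
/-- The edges of `G` with both endpoints in `s`. -/
noncomputable def edgesIn (G : SimpleGraph V) (s : Finset V) : Finset G.edgeSet :=
  s.sym2.subtype (· ∈ G.edgeSet)

theorem mem_edgesIn {G : SimpleGraph V} {s : Finset V} {u v : V} (h : G.Adj u v) :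
    (⟨s(u, v), h⟩ : G.edgeSet) ∈ edgesIn G s ↔ u ∈ s ∧ v ∈ s := by
  simp [edgesIn]

theorem openGraph_openOn_adj {G : SimpleGraph V} (s : Finset V) (ω : Config G) (u v : V) :
    (openGraph G (openOn (edgesIn G s : Set G.edgeSet) ω)).Adj u v ↔
      (openGraph G ω).Adj u v ∨ (G.Adj u v ∧ u ∈ s ∧ v ∈ s) := by
  by_cases h : G.Adj u v
  · simp only [openGraph, h, exists_true_left, true_and, openOn, Finset.mem_coe, mem_edgesIn h]
    rw [← mem_edgesIn h]
    split_ifs with hs <;> simp_all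
  · simp [openGraph, h]

theorem le_openGraph_openOn {G : SimpleGraph V} (s : Finset V) (ω : Config G) :
    openGraph G ω ≤ openGraph G (openOn (edgesIn G s : Set G.edgeSet) ω) :=
  fun u v h => (openGraph_openOn_adj s ω u v).2 (Or.inl h)

theorem del_openGraph_openOn {G : SimpleGraph V} (s : Finset V) (ω : Config G) :
    del (openGraph G (openOn (edgesIn G s : Set G.edgeSet) ω)) s = del (openGraph G ω) s := by
  ext u v
  simp only [del, openGraph_openOn_adj]
  constructor
  · rintro ⟨h | h, hu, hv⟩
    · exact ⟨h, hu, hv⟩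
    · exact absurd h.2.1 hu
  · rintro ⟨h, hu, hv⟩
    exact ⟨Or.inl h, hu, hv⟩

/-- Some fixed ball meets three infinite clusters with positive probability. Deleting the ball
leaves in each an infinite component adjacent to it. These remain separated when the edges of the
ball are opened, because that does not change the graph off the ball. -/
theorem exists_isEncounter_pos [Countable V] (G : SimpleGraph V) (hG : G.Connected)
    (hfin : ∀ v, (G.neighborSet v).Finite) (w : G.edgeSet → I) (hw : ∀ e, 0 < w e) (x : V)
    (h : bernoulliPi w {ω : Config G | HasThreeInfinite (openGraph G ω)} ≠ 0) :
    ∃ R, bernoulliPi w {ω : Config G | IsEncounter G (openGraph G ω) R x} ≠ 0 := by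
  have h1 : ∃ R : ℕ, bernoulliPi w {ω : Config G | ∃ c : Fin 3 → V, (∀ i, c i ∈ cball G R x) ∧
      (∀ i, (comp (openGraph G ω) (c i)).Infinite) ∧
      ∀ i j, i ≠ j → ¬ (openGraph G ω).Reachable (c i) (c j)} ≠ 0 := by
    by_contra hcon
    push Not at hcon
    refine h (measure_mono_null ?_ (measure_iUnion_null hcon))
    rintro ω ⟨c, hc⟩
    classical
    obtain ⟨R, hR⟩ := exists_finset_subset_cball G hG x (Finset.univ.image c)
    exact Set.mem_iUnion.2 ⟨R, c, fun i => hR (by simp), hc⟩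
  obtain ⟨R, hR⟩ := h1
  refine ⟨R, ?_⟩
  have hB := cball_finite G hfin R x
  refine bernoulliPi_pos_of_openOn w (edgesIn G hB.toFinset) (fun e _ => hw e)
    (measurableSet_isEncounter G R x) hR ?_
  rintro ω ⟨c, hcB, hcinf, hcsep⟩
  have hfin' : ∀ v, ((openGraph G ω).neighborSet v).Finite := fun v =>
    (hfin v).subset fun _ h => h.1
  have hex := fun i => exists_infinite_del_comp hfin' hB (hcinf i) (hcB i) .rfl
  choose c' _ hadj hreach hinf using hex
  have hdel : del (openGraph G (openOn (edgesIn G hB.toFinset : Set G.edgeSet) ω)) (cball G R x) =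
      del (openGraph G ω) (cball G R x) := by
    have := del_openGraph_openOn hB.toFinset ω
    rwa [hB.coe_toFinset] at this
  refine ⟨fun u hu v hv huv => (openGraph_openOn_adj _ _ _ _).2 (Or.inr ⟨huv, by simpa using hu,
    by simpa using hv⟩), c', fun i => ⟨?_, ?_⟩, fun i j hij hr => ?_⟩
  · obtain ⟨b, hb, hbc⟩ := hadj i
    exact ⟨b, hb, le_openGraph_openOn _ _ hbc⟩
  · rw [hdel]; exact hinf i
  · rw [hdel] at hr
    exact hcsep i j hij ((hreach i).trans ((hr.mono (del_le _ _)).trans (hreach j).symm))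

/-- With at most two infinite clusters, some fixed ball meets all of them with positive probability.
Once its edges are opened, a cluster missing the ball is contained in an old cluster missing it,
hence is finite. All infinite clusters therefore pass through the connected ball. -/
theorem hasUniqueInfinite_pos [Countable V] (G : SimpleGraph V) (hG : G.Connected)
    (hfin : ∀ v, (G.neighborSet v).Finite) (w : G.edgeSet → I) (hw : ∀ e, 0 < w e) (x : V)
    (h : bernoulliPi w {ω : Config G | (∃ u, (comp (openGraph G ω) u).Infinite) ∧
      ¬ HasThreeInfinite (openGraph G ω)} ≠ 0) :
    bernoulliPi w {ω : Config G | HasUniqueInfinite (openGraph G ω)} ≠ 0 := by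
  have h1 : ∃ R : ℕ, bernoulliPi w {ω : Config G | (∃ u, (comp (openGraph G ω) u).Infinite) ∧
      ∀ v, (comp (openGraph G ω) v).Infinite → ∃ b ∈ cball G R x,
        (openGraph G ω).Reachable v b} ≠ 0 := by
    by_contra hcon
    push Not at hcon
    refine h (measure_mono_null ?_ (measure_iUnion_null hcon))
    rintro ω ⟨⟨u, hu⟩, h3⟩
    -- Otherwise a second cluster `u'` and then a third `v` could be chosen outside the clusters
    -- already listed.
    have h2 : ∃ u', ∀ v, (comp (openGraph G ω) v).Infinite →
        (openGraph G ω).Reachable v u ∨ (openGraph G ω).Reachable v u' := by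
      by_contra hc
      push Not at hc
      obtain ⟨u', hu', h1, -⟩ := hc u
      obtain ⟨v, hv, h4, h5⟩ := hc u'
      refine h3 ⟨![u, u', v], ?_, ?_⟩
      · intro i; fin_cases i
        · exact hu
        · exact hu'
        · exact hv
      · intro i j hij
        fin_cases i <;> fin_cases j <;> first
          | exact absurd rfl hij
          | exact h1
          | exact h4
          | exact h5
          | exact fun h => h1 h.symm
          | exact fun h => h4 h.symm
          | exact fun h => h5 h.symm
    obtain ⟨u', hu'⟩ := h2
    classical
    obtain ⟨R, hR⟩ := exists_finset_subset_cball G hG x {u, u'}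
    refine Set.mem_iUnion.2 ⟨R, ⟨u, hu⟩, fun v hv => ?_⟩
    rcases hu' v hv with h | h
    · exact ⟨u, hR (by simp), h⟩
    · exact ⟨u', hR (by simp), h⟩
  obtain ⟨R, hR⟩ := h1
  have hB := cball_finite G hfin R x
  refine bernoulliPi_pos_of_openOn w (edgesIn G hB.toFinset) (fun e _ => hw e)
    (measurableSet_hasUniqueInfinite G) hR ?_
  rintro ω ⟨⟨u, hu⟩, hall⟩
  set H := openGraph G ω
  set H' := openGraph G (openOn (edgesIn G hB.toFinset : Set G.edgeSet) ω)
  have hle : H ≤ H' := le_openGraph_openOn _ _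
  have hx : ∀ v, (comp H' v).Infinite → H'.Reachable v x := by
    intro v hv
    have hb : ∃ b ∈ cball G R x, H'.Reachable v b := by
      by_contra hcon
      push Not at hcon
      have hvH : (comp H v).Infinite := hv.mono fun z hz => by
        refine reachable_mono_on (fun a b ha hab => ?_) hz
        rcases (openGraph_openOn_adj _ _ _ _).1 hab with h | h
        · exact h
        · exact absurd ha (hcon a (by simpa using h.2.1))
      obtain ⟨b, hb, hvb⟩ := hall v hvH
      exact hcon b hb (hvb.mono hle)
    obtain ⟨b, hb, hvb⟩ := hb
    refine hvb.trans (SimpleGraph.Reachable.symm (reachable_of_mem_cball (G := G) ?_ hb))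
    exact fun u hu v hv huv => (openGraph_openOn_adj _ _ _ _).2
      (Or.inr ⟨huv, by simpa using hu, by simpa using hv⟩)
  exact ⟨⟨u, hu.mono fun z hz => hz.mono hle⟩, fun a b ha hb => (hx a ha).trans (hx b hb).symm⟩

end Events

/-! ### Encounter points versus exits from a finite subset of `S`. -/

section Counting

variable {V : Type*}

theorem mem_of_del_compl_reachable {H : SimpleGraph V} {Z : Set V} {x y : V}
    (h : (del H Zᶜ).Reachable x y) (hx : x ∈ Z) : y ∈ Z := by
  obtain ⟨p⟩ := h
  induction p with
  | nil => exact hx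
  | cons hab _ ih => exact ih (not_not.1 hab.2.2)

/-- An infinite component adjacent to a connected ball that contains a point of `K` contains a
point of the set `L` of exits from `K`, unless the ball does. -/
theorem exists_exit_of_infinite_comp {H : SimpleGraph V} (hfin : ∀ v, (H.neighborSet v).Finite)
    {S : Set V} (hout : ∀ v, (comp (outer H S) v).Finite) {K L : Finset V} (hKS : (K : Set V) ⊆ S)
    (hL : ∀ y ∈ K, ∀ z ∈ S, z ∉ K → Excursion H S y z → y ∈ L) {B : Set V} {x c : V}
    (hx : x ∈ K) (hxB : x ∈ B) (hB : ∀ v ∈ B, (del H Bᶜ).Reachable x v)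
    (hBL : ∀ y ∈ L, y ∉ B) (hadj : ∃ b ∈ B, H.Adj b c) (hinf : (comp (del H B) c).Infinite) :
    ∃ y ∈ L, (del H B).Reachable c y := by
  obtain ⟨s, hs, hsK, hcs⟩ := exists_mem_comp_diff hfin K.finite_toSet hout hinf
  obtain ⟨b, hb, hbc⟩ := hadj
  -- Confining the walk from `x` to `s` to `Z` forces the exit point it produces into the component
  -- of `c` or into `B`, and `B` contains no exit.
  set Z : Set V := comp (del H B) c ∪ B with hZ
  have hcZ : c ∈ Z := Or.inl SimpleGraph.Reachable.rfl
  have h1 : (del H Zᶜ).Reachable x b := by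
    refine reachable_mono_on (H := del H Bᶜ) (fun u v _ huv => ⟨huv.1, ?_, ?_⟩) (hB b hb)
    · exact fun h => h (Or.inr (not_not.1 huv.2.1))
    · exact fun h => h (Or.inr (not_not.1 huv.2.2))
  have h2 : (del H Zᶜ).Adj b c := ⟨hbc, fun h => h (Or.inr hb), fun h => h hcZ⟩
  have h3 : (del H Zᶜ).Reachable c s :=
    reachable_mono_on (H := del H B) (fun u v hu huv => ⟨huv.1, fun h => h (Or.inl hu),
      fun h => h (Or.inl (SimpleGraph.Reachable.trans hu huv.reachable))⟩) hcs
  obtain ⟨y, hy, z, hz, hzK, hxy, hexc⟩ := exists_excursion hKS (Finset.mem_coe.2 hx) hs hsK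
    (h1.trans (h2.reachable.trans h3))
  have hyL := hL y hy z hz hzK (hexc.mono (del_le _ _))
  rcases mem_of_del_compl_reachable hxy (Or.inr hxB) with h | h
  · exact ⟨y, hyL, h⟩
  · exact absurd h (hBL y hyL)

/-- Separated encounter points in `K` are at most twice as many as the exits from `K`. -/
theorem card_encounters_le {G H : SimpleGraph V} (hfin : ∀ v, (H.neighborSet v).Finite)
    {S : Set V} (hout : ∀ v, (comp (outer H S) v).Finite) {K L T : Finset V}
    (hKS : (K : Set V) ⊆ S) (hL : ∀ y ∈ K, ∀ z ∈ S, z ∉ K → Excursion H S y z → y ∈ L)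
    (hTK : T ⊆ K) {R : ℕ} (hsep : ∀ x ∈ T, ∀ y ∈ T, x ≠ y → y ∉ cball G (R + R) x)
    (hT : ∀ x ∈ T, IsEncounter G H R x) : T.card ≤ 2 * L.card := by
  classical
  have hdis : ∀ x ∈ T, ∀ y ∈ T, x ≠ y → Disjoint (cball G R x) (cball G R y) := by
    intro x hx y hy hxy
    rw [Set.disjoint_left]
    exact fun v hv hv' => hsep x hx y hy hxy (cball_trans G hv (cball_symm G hv'))
  -- Balls containing an exit are counted by that exit, since the balls are disjoint. The other
  -- balls fall under `card_le_of_separating`. This gives the factor two.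
  have h1 : (T.filter fun x => ∃ y ∈ L, y ∈ cball G R x).card ≤ L.card := by
    have : ∃ f : V → V, ∀ x ∈ T.filter fun x => ∃ y ∈ L, y ∈ cball G R x,
        f x ∈ L ∧ f x ∈ cball G R x := by
      have h : ∀ x ∈ T.filter fun x => ∃ y ∈ L, y ∈ cball G R x, ∃ y, y ∈ L ∧ y ∈ cball G R x :=
        fun x hx => (Finset.mem_filter.1 hx).2
      choose! f hf using h
      exact ⟨f, hf⟩
    obtain ⟨f, hf⟩ := this
    refine Finset.card_le_card_of_injOn f (fun x hx => (hf x hx).1) fun x hx y hy hxy => ?_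
    by_contra hne
    refine Set.disjoint_left.1 (hdis x (Finset.mem_filter.1 hx).1 y (Finset.mem_filter.1 hy).1 hne)
      (hf x hx).2 ?_
    rw [hxy]
    exact (hf y hy).2
  have h2 : (T.filter fun x => ¬ ∃ y ∈ L, y ∈ cball G R x).card ≤ L.card := by
    have hmem : ∀ x ∈ T.filter fun x => ¬ ∃ y ∈ L, y ∈ cball G R x,
        x ∈ T ∧ ∀ y ∈ L, y ∉ cball G R x := by
      intro x hx
      have := Finset.mem_filter.1 hx
      push Not at this
      exact this
    have hc : ∃ c : V → Fin 3 → V, ∀ x ∈ T, (∀ i, (∃ b ∈ cball G R x, H.Adj b (c x i)) ∧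
        (comp (del H (cball G R x)) (c x i)).Infinite) ∧
        ∀ i j, i ≠ j → ¬ (del H (cball G R x)).Reachable (c x i) (c x j) := by
      have := fun x hx => (hT x hx).2
      choose! c hc using this
      exact ⟨c, hc⟩
    obtain ⟨c, hc⟩ := hc
    have hball : ∀ x ∈ T, ∀ Y : Set V, Disjoint (cball G R x) Y → ∀ v ∈ cball G R x,
        (del H Y).Reachable x v := by
      intro x hx Y hY v hv
      refine reachable_of_mem_cball (G := G) (fun a ha b hb hab => ?_) hv
      exact ⟨(hT x hx).1 a ha b hb hab, Set.disjoint_left.1 hY ha, Set.disjoint_left.1 hY hb⟩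
    let _ : LinearOrder V := IsWellOrder.linearOrder WellOrderingRel
    refine card_le_of_separating H L _ (cball G R) id c ?_ ?_ ?_ ?_ ?_ ?_ ?_
    · exact fun x hx y hy => hdis x (hmem x hx).1 y (hmem y hy).1
    · exact fun x _ => mem_cball_self G R x
    · exact fun x hx y hy hxy => hball x (hmem x hx).1 _ (hdis x (hmem x hx).1 y (hmem y hy).1 hxy)
    · exact fun x hx v hv => (hball x (hmem x hx).1 ∅ (Set.disjoint_empty _) v hv).mono (del_le _ _)
    · exact fun x hx i => ((hc x (hmem x hx).1).1 i).1
    · exact fun x hx => (hc x (hmem x hx).1).2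
    · intro x hx i
      obtain ⟨hxT, hxL⟩ := hmem x hx
      exact exists_exit_of_infinite_comp hfin hout hKS hL (hTK hxT) (mem_cball_self G R x)
        (hball x hxT _ disjoint_compl_right) hxL ((hc x hxT).1 i).1 ((hc x hxT).1 i).2
  have := Finset.card_filter_add_card_filter_not (s := T) (fun x => ∃ y ∈ L, y ∈ cball G R x)
  omega

/-- Greedy choice: a point is added only if no earlier chosen ball covers it. -/
theorem exists_separated_subset {G : SimpleGraph V} (n : ℕ) (K : Finset V) :
    ∃ K₀ ⊆ K, (∀ x ∈ K₀, ∀ y ∈ K₀, x ≠ y → y ∉ cball G n x) ∧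
      ∀ y ∈ K, ∃ x ∈ K₀, y ∈ cball G n x := by
  classical
  induction K using Finset.induction_on with
  | empty => exact ⟨∅, by simp⟩
  | insert a K _ ih =>
    obtain ⟨K₀, hK₀, hsep, hcov⟩ := ih
    by_cases ha : ∃ x ∈ K₀, a ∈ cball G n x
    · refine ⟨K₀, hK₀.trans (Finset.subset_insert _ _), hsep, fun y hy => ?_⟩
      rcases Finset.mem_insert.1 hy with rfl | hy
      · exact ha
      · exact hcov y hy
    · push Not at ha
      refine ⟨insert a K₀, Finset.insert_subset_insert _ hK₀, fun x hx y hy hxy => ?_,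
        fun y hy => ?_⟩
      · rcases Finset.mem_insert.1 hx with rfl | hx' <;>
          rcases Finset.mem_insert.1 hy with rfl | hy'
        · exact absurd rfl hxy
        · exact fun h => ha y hy' (cball_symm G h)
        · exact ha x hx'
        · exact hsep x hx' y hy' hxy
      · rcases Finset.mem_insert.1 hy with rfl | hy
        · exact ⟨y, Finset.mem_insert_self _ _, mem_cball_self G n y⟩
        · obtain ⟨x, hx, h⟩ := hcov y hy
          exact ⟨x, Finset.mem_insert_of_mem hx, h⟩

theorem card_le_of_cover {G : SimpleGraph V} (d : ℕ) (hfin : ∀ v, (G.neighborSet v).Finite)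
    (hd : ∀ v, (G.neighborSet v).ncard ≤ d) (n : ℕ) (K K₀ : Finset V)
    (h : ∀ y ∈ K, ∃ x ∈ K₀, y ∈ cball G n x) : K.card ≤ K₀.card * (d + 1) ^ n := by
  classical
  have hsub : K ⊆ K₀.biUnion fun x => (cball_finite G hfin n x).toFinset := by
    intro y hy
    obtain ⟨x, hx, hxy⟩ := h y hy
    exact Finset.mem_biUnion.2 ⟨x, hx, by simpa using hxy⟩
  refine (Finset.card_le_card hsub).trans (Finset.card_biUnion_le_card_mul _ _ _ fun x _ => ?_)
  rw [← Set.ncard_eq_toFinset_card _ (cball_finite G hfin n x)]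
  exact cball_ncard_le G d hfin hd n x

theorem exists_mem_innerBoundary {G : SimpleGraph V} {K : Set V} {n : ℕ} {y v : V} (hy : y ∈ K)
    (hv : v ∈ cball G n y) (hvK : v ∉ K) : ∃ b ∈ innerBoundary G K, b ∈ cball G n y := by
  induction n generalizing v with
  | zero => exact absurd hy ((show v = y from hv) ▸ hvK)
  | succ n ih =>
    rcases hv with hv | ⟨w, hw, hwv⟩
    · obtain ⟨b, hb, h⟩ := ih hv hvK
      exact ⟨b, hb, Or.inl h⟩
    · by_cases hwK : w ∈ K
      · exact ⟨w, ⟨hwK, v, hvK, hwv.symm⟩, Or.inl hw⟩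
      · obtain ⟨b, hb, h⟩ := ih hw hwK
        exact ⟨b, hb, Or.inl h⟩

open Classical in
theorem card_near_boundary_le {G : SimpleGraph V} (d : ℕ) (hfin : ∀ v, (G.neighborSet v).Finite)
    (hd : ∀ v, (G.neighborSet v).ncard ≤ d) (n : ℕ) (K : Finset V) :
    (K.filter fun y => ¬ cball G n y ⊆ K).card ≤
      (innerBoundary G (K : Set V)).ncard * (d + 1) ^ n := by
  have hbf : (innerBoundary G (K : Set V)).Finite := K.finite_toSet.subset fun y hy => hy.1
  rw [Set.ncard_eq_toFinset_card _ hbf]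
  refine card_le_of_cover d hfin hd n _ _ fun y hy => ?_
  obtain ⟨hyK, hsub⟩ := Finset.mem_filter.1 hy
  obtain ⟨v, hv, hvK⟩ := Set.not_subset.1 hsub
  obtain ⟨b, hb, hby⟩ := exists_mem_innerBoundary (Finset.mem_coe.2 hyK) hv hvK
  exact ⟨b, by simpa using hb, cball_symm G hby⟩

open Classical in
/-- A pointwise bound between numbers of occurring events gives a bound between the sums of their
probabilities. -/
theorem sum_measureReal_le {Ω ι κ : Type*} [MeasurableSpace Ω] (μ : Measure Ω)
    [IsProbabilityMeasure μ] (s : Finset ι) (t : Finset κ) (A : ι → Set Ω) (B : κ → Set Ω)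
    (hA : ∀ i, MeasurableSet (A i)) (hB : ∀ j, MeasurableSet (B j)) (n : ℕ)
    (h : ∀ᵐ ω ∂μ, (s.filter fun i => ω ∈ A i).card ≤ 2 * (n + (t.filter fun j => ω ∈ B j).card)) :
    ∑ i ∈ s, μ.real (A i) ≤ 2 * (n + ∑ j ∈ t, μ.real (B j)) := by
  have hi : ∀ C : Set Ω, MeasurableSet C → Integrable (C.indicator fun _ => (1 : ℝ)) μ :=
    fun C hC => (integrable_const 1).indicator hC
  have e1 : ∑ i ∈ s, μ.real (A i) = ∫ ω, ∑ i ∈ s, (A i).indicator (fun _ => (1 : ℝ)) ω ∂μ := by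
    rw [integral_finsetSum _ fun i _ => hi _ (hA i)]
    exact Finset.sum_congr rfl fun i _ => (integral_indicator_one (hA i)).symm
  have e2 : 2 * (n + ∑ j ∈ t, μ.real (B j)) =
      ∫ ω, 2 * (n + ∑ j ∈ t, (B j).indicator (fun _ => (1 : ℝ)) ω) ∂μ := by
    rw [integral_const_mul, integral_add (integrable_const _)
      (integrable_finsetSum _ fun j _ => hi _ (hB j)), integral_finsetSum _ fun j _ => hi _ (hB j)]
    simp only [integral_const, probReal_univ, one_smul]
    congr 2
    exact Finset.sum_congr rfl fun j _ => (integral_indicator_one (hB j)).symm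
  rw [e1, e2]
  refine integral_mono_ae (integrable_finsetSum _ fun i _ => hi _ (hA i))
    (((integrable_const _).add (integrable_finsetSum _ fun j _ => hi _ (hB j))).const_mul 2) ?_
  filter_upwards [h] with ω hω
  simp only [Set.indicator_apply, Finset.sum_boole]
  exact_mod_cast hω

end Counting

/-! ### Percolation with parameters `p` and `q`: invariance, subcritical outer clusters and
Burton–Keane. -/

section Uniqueness

variable {V : Type*}

theorem neighborSet_of_iSup_encard {G : SimpleGraph V} {d : ℕ}
    (hd : ⨆ v, (G.neighborSet v).encard = (d : ℕ∞)) (v : V) :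
    (G.neighborSet v).Finite ∧ (G.neighborSet v).ncard ≤ d := by
  have h : (G.neighborSet v).encard ≤ d := hd ▸ le_iSup (fun v => (G.neighborSet v).encard) v
  have hf := Set.finite_of_encard_le_coe h
  refine ⟨hf, ?_⟩
  rw [← hf.cast_ncard_eq] at h
  exact_mod_cast h

theorem neighborSet_induce {G : SimpleGraph V} {d : ℕ} (S : Set V)
    (h : ∀ v, (G.neighborSet v).Finite ∧ (G.neighborSet v).ncard ≤ d) (v : S) :
    ((G.induce S).neighborSet v).Finite ∧ ((G.induce S).neighborSet v).ncard ≤ d := by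
  have hsub : Subtype.val '' (G.induce S).neighborSet v ⊆ G.neighborSet v := by
    rintro _ ⟨u, hu, rfl⟩
    exact hu
  refine ⟨((h v).1.subset hsub).of_finite_image Subtype.val_injective.injOn, ?_⟩
  rw [← Set.ncard_image_of_injective _ Subtype.val_injective]
  exact (Set.ncard_le_ncard hsub (h v).1).trans (h v).2

/-- On a finite graph nothing percolates even at parameter `1`, so the supremum is `1`. -/
theorem infinite_of_criticalProb_lt {G : SimpleGraph V} {o : V} (h : criticalProb G o < 1) :
    Infinite V := by
  by_contra hV
  rw [not_infinite_iff_finite] at hV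
  refine h.not_ge (le_sSup ?_)
  have : percolates G o = ∅ := Set.eq_empty_of_forall_notMem fun ω hω => hω (Set.toFinite _)
  simp [this]

open Classical in
/-- The edge parameters of `inhomPerc`. -/
noncomputable def inhomWeight (G : SimpleGraph V) (S : Set V) (p q : I) : G.edgeSet → I :=
  fun e => if ∀ v ∈ (e : Sym2 V), v ∈ S then q else p

theorem inhomPerc_eq (G : SimpleGraph V) (S : Set V) (p q : I) :
    inhomPerc G S p q = bernoulliPi (inhomWeight G S p q) := rfl

theorem inhomWeight_pos (G : SimpleGraph V) (S : Set V) {p q : I} (hp : 0 < p) (hq : 0 < q)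
    (e : G.edgeSet) : 0 < inhomWeight G S p q e := by
  unfold inhomWeight
  split_ifs
  · exact hq
  · exact hp

theorem inhomWeight_map {G : SimpleGraph V} {S : Set V} (p q : I) (g : G ≃g G)
    (hg : ∀ v, g v ∈ S ↔ v ∈ S) (e : G.edgeSet) :
    inhomWeight G S p q (g.mapEdgeSet e) = inhomWeight G S p q e := by
  obtain ⟨e, he⟩ := e
  induction e using Sym2.ind with
  | _ a b =>
    have : (∀ v ∈ ((g.mapEdgeSet ⟨s(a, b), he⟩ : G.edgeSet) : Sym2 V), v ∈ S) ↔
        ∀ v ∈ s(a, b), v ∈ S := by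
      simp [SimpleGraph.Iso.mapEdgeSet, SimpleGraph.Hom.mapEdgeSet, hg]
    by_cases h : ∀ v ∈ s(a, b), v ∈ S
    · exact (if_pos (this.2 h)).trans (if_pos h).symm
    · exact (if_neg fun h' => h (this.1 h')).trans (if_neg h).symm

theorem ActsTransitivelyOn.mem_iff {G : SimpleGraph V} {Γ : Subgroup (G ≃g G)} {S : Set V}
    (h : ActsTransitivelyOn Γ S) {g : G ≃g G} (hg : g ∈ Γ) (v : V) : g v ∈ S ↔ v ∈ S := by
  have hS := h.1 g hg
  constructor
  · intro hv
    rw [← hS] at hv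
    obtain ⟨u, hu, huv⟩ := hv
    rwa [← g.injective huv]
  · intro hv
    rw [← hS]
    exact ⟨v, hv, rfl⟩

theorem measurePreserving_automorphism {G : SimpleGraph V} {S : Set V} (p q : I) (g : G ≃g G)
    (hg : ∀ v, g v ∈ S ↔ v ∈ S) :
    MeasurePreserving (fun (ω : Config G) e => ω (g.mapEdgeSet e))
      (bernoulliPi (inhomWeight G S p q)) (bernoulliPi (inhomWeight G S p q)) :=
  measurePreserving_reindex _ g.mapEdgeSet (inhomWeight_map p q g hg)

/-- Automorphisms acting transitively on an infinite set move finite sets of edges off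
themselves. -/
theorem exists_displacing {G : SimpleGraph V} (hG : G.Connected)
    (hfin : ∀ v, (G.neighborSet v).Finite) {S : Set V} (hS : S.Infinite) {Γ : Subgroup (G ≃g G)}
    (hΓ : ActsTransitivelyOn Γ S) (F : Finset G.edgeSet) :
    ∃ g ∈ Γ, ∀ e ∈ F, g.mapEdgeSet e ∉ F := by
  classical
  obtain ⟨x, hx⟩ := hS.nonempty
  obtain ⟨R, hR⟩ := exists_finset_subset_cball G hG x
    (F.biUnion fun e => (e : Sym2 V).toFinset)
  have hFR : ∀ e ∈ F, ∀ v ∈ (e : Sym2 V), v ∈ cball G R x := fun e he v hv =>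
    hR (Finset.mem_coe.2 (Finset.mem_biUnion.2 ⟨e, he, Sym2.mem_toFinset.2 hv⟩))
  -- The vertices of `F` lie within `R` of `x`. If both `e` and its image were in `F`, then `g x`
  -- would be within `2R` of `x`.
  obtain ⟨s, hs, hsx⟩ := hS.exists_notMem_finset (cball_finite G hfin (R + R) x).toFinset
  obtain ⟨g, hg, rfl⟩ := hΓ.2 x hx s hs
  refine ⟨g, hg, fun e he hge => hsx ?_⟩
  obtain ⟨⟨e, he'⟩⟩ := e
  have h1 : g x ∈ cball G R (g _) := cball_symm G
    ((mem_cball_map_iff g.toEquiv (fun u v => g.map_adj_iff.symm) R x _).2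
      (hFR _ he _ (Sym2.mem_mk_left _ _)))
  have h2 := hFR _ hge (g _) (Sym2.mem_mk_left _ _)
  simpa using cball_trans G h2 h1

theorem hasUniqueInfinite_zero_or_one {G : SimpleGraph V} [Countable V] (hG : G.Connected)
    (hfin : ∀ v, (G.neighborSet v).Finite) {S : Set V} (hS : S.Infinite) {Γ : Subgroup (G ≃g G)}
    (hΓ : ActsTransitivelyOn Γ S) (p q : I) :
    bernoulliPi (inhomWeight G S p q) {ω : Config G | HasUniqueInfinite (openGraph G ω)} = 0 ∨
      bernoulliPi (inhomWeight G S p q) {ω : Config G | HasUniqueInfinite (openGraph G ω)} = 1 := by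
  refine bernoulliPi_zero_or_one _ _ (measurableSet_hasUniqueInfinite G) fun F => ?_
  obtain ⟨g, hg, hF⟩ := exists_displacing hG hfin hS hΓ F
  refine ⟨g.mapEdgeSet, inhomWeight_map p q g (hΓ.mem_iff hg), hF, ?_⟩
  ext ω
  exact hasUniqueInfinite_map_iff g.toEquiv (openGraph_mapEdgeSet_adj g ω)

theorem isEncounter_measure_eq {G : SimpleGraph V} [Countable V] {S : Set V}
    {Γ : Subgroup (G ≃g G)} (hΓ : ActsTransitivelyOn Γ S) (p q : I) (R : ℕ) {x y : V}
    (hx : x ∈ S) (hy : y ∈ S) :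
    bernoulliPi (inhomWeight G S p q) {ω : Config G | IsEncounter G (openGraph G ω) R y} =
      bernoulliPi (inhomWeight G S p q) {ω : Config G | IsEncounter G (openGraph G ω) R x} := by
  obtain ⟨g, hg, rfl⟩ := hΓ.2 x hx y hy
  rw [← (measurePreserving_automorphism p q g (hΓ.mem_iff hg)).measure_preimage
    (measurableSet_isEncounter G R x).nullMeasurableSet]
  congr 1
  ext ω
  exact (isEncounter_map_iff g.toEquiv (fun u v => g.map_adj_iff.symm)
    (openGraph_mapEdgeSet_adj g ω) R x).symm

/-- Outside the edges of `S`, the point `y` is connected in `H` to a point of `S` at distance more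
than `n` in the graph induced on `S`. -/
def FarExcursion (G H : SimpleGraph V) (S : Set V) (n : ℕ) (y : S) : Prop :=
  ∃ z : S, z ∉ cball (G.induce S) n y ∧ (outer H S).Reachable (y : V) z

theorem measurableSet_farExcursion [Countable V] (G : SimpleGraph V) (S : Set V) (n : ℕ) (y : S) :
    MeasurableSet {ω : Config G | FarExcursion G (openGraph G ω) S n y} :=
  measurableSet_setOfPred.2 (Measurable.exists fun _ => measurable_const.and
    (measurable_reachable (measurable_outer_adj G S) _ _))

theorem farExcursion_measure_eq {G : SimpleGraph V} [Countable V] {S : Set V}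
    {Γ : Subgroup (G ≃g G)} (hΓ : ActsTransitivelyOn Γ S) (p q : I) (n : ℕ) (x y : S) :
    bernoulliPi (inhomWeight G S p q) {ω : Config G | FarExcursion G (openGraph G ω) S n y} =
      bernoulliPi (inhomWeight G S p q) {ω : Config G | FarExcursion G (openGraph G ω) S n x} := by
  obtain ⟨g, hg, hgx⟩ := hΓ.2 x x.2 y y.2
  have hgS := hΓ.mem_iff hg
  let φ : S ≃ S := g.toEquiv.subtypeEquiv fun v => (hgS v).symm
  obtain rfl : φ x = y := Subtype.ext hgx
  rw [← (measurePreserving_automorphism p q g hgS).measure_preimage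
    (measurableSet_farExcursion G S n x).nullMeasurableSet]
  congr 1
  ext ω
  refine (φ.exists_congr fun z => and_congr (not_congr ?_) ?_).symm
  · exact (mem_cball_map_iff φ (fun u v => g.map_adj_iff.symm) n x z).symm
  · refine (reachable_map_iff g.toEquiv (fun u v => ?_) (x : V) z).symm
    exact and_congr (openGraph_mapEdgeSet_adj g ω u v) (not_congr (and_congr (hgS u) (hgS v)).symm)

/-- At `o` this is monotone coupling with a larger parameter in the defining set. For another root
`u`, opening a ball about `o` that contains `u` would turn percolation from `u` into percolation
from `o`. -/
theorem percolates_eq_zero_of_lt_criticalProb {G : SimpleGraph V} [Countable V] (hG : G.Connected)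
    (hfin : ∀ v, (G.neighborSet v).Finite) {o : V} {p : I} (hp : 0 < p)
    (hlt : p < criticalProb G o) (u : V) :
    bernoulliPi (fun _ : G.edgeSet => p) (percolates G u) = 0 := by
  have hm : ∀ u, MeasurableSet (percolates G u) := fun u =>
    measurableSet_setOfPred.2 (measurable_infinite_comp (measurable_openGraph_adj G) u)
  obtain ⟨p', hp', hpp'⟩ := lt_sSup_iff.1 hlt
  have ho : bernoulliPi (fun _ : G.edgeSet => p) (percolates G o) = 0 := by
    refine le_antisymm (le_trans (bernoulliPi_le_of_threshold _ (fun _ => p') (hm o) (hm o) ?_)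
      (le_of_eq hp')) zero_le
    intro U hU
    refine hU.mono fun v hv => SimpleGraph.Reachable.mono ?_ hv
    rintro a b ⟨hab, h⟩
    refine ⟨hab, ?_⟩
    simp only [threshold, decide_eq_true_eq] at h ⊢
    exact h.trans hpp'.le
  by_contra hu
  obtain ⟨R, hR⟩ := exists_mem_cball G (hG.preconnected o u)
  have hB := cball_finite G hfin R o
  refine bernoulliPi_pos_of_openOn _ (edgesIn G hB.toFinset) (fun _ _ => hp) (hm o) hu ?_ ho
  intro ω hω
  have hou : (openGraph G (openOn (edgesIn G hB.toFinset : Set G.edgeSet) ω)).Reachable o u :=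
    reachable_of_mem_cball (G := G) (fun a ha b hb hab => (openGraph_openOn_adj _ _ _ _).2
      (Or.inr ⟨hab, by simpa using ha, by simpa using hb⟩)) hR
  exact Set.Infinite.mono (fun z hz => hou.trans (hz.mono (le_openGraph_openOn _ _))) hω

/-- The edges of the outer graph all have parameter `p`, so under the coupling its components lie
inside clusters of homogeneous percolation at `p`. -/
theorem ae_finite_outer_comp {G : SimpleGraph V} [Countable V] (hG : G.Connected)
    (hfin : ∀ v, (G.neighborSet v).Finite) (S : Set V) {o : V} {p : I} (hp : 0 < p)
    (hlt : p < criticalProb G o) (q : I) :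
    ∀ᵐ ω ∂bernoulliPi (inhomWeight G S p q), ∀ v, (comp (outer (openGraph G ω) S) v).Finite := by
  rw [ae_all_iff]
  intro u
  rw [ae_iff]
  refine le_antisymm (le_trans (bernoulliPi_le_of_threshold _ (fun _ => p)
    (measurableSet_setOfPred.2 (measurable_infinite_comp (measurable_outer_adj G S) u))
    (measurableSet_setOfPred.2 (measurable_infinite_comp (measurable_openGraph_adj G) u)) ?_)
    (percolates_eq_zero_of_lt_criticalProb hG hfin hp hlt u).le) zero_le
  intro U hU
  refine Set.Infinite.mono (fun v hv => SimpleGraph.Reachable.mono ?_ hv) hU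
  rintro a b ⟨⟨hab, h⟩, hS⟩
  refine ⟨hab, ?_⟩
  have hw : inhomWeight G S p q ⟨s(a, b), hab⟩ = p := by
    rw [inhomWeight, if_neg]
    simpa using hS
  simpa [threshold, hw] using h

/-- The events decrease in `n`. A finite outer component meets `S` inside some ball of the induced
graph, so their intersection is null. -/
theorem exists_farExcursion_lt {G : SimpleGraph V} [Countable V] {S : Set V}
    (hS : (G.induce S).Connected) (w : G.edgeSet → I)
    (hout : ∀ᵐ ω ∂bernoulliPi w, ∀ v, (comp (outer (openGraph G ω) S) v).Finite) (x : S)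
    {η : ℝ} (hη : 0 < η) :
    ∃ n, 1 ≤ n ∧
      (bernoulliPi w).real {ω : Config G | FarExcursion G (openGraph G ω) S n x} < η := by
  have hanti : Antitone fun n => {ω : Config G | FarExcursion G (openGraph G ω) S n x} := by
    rintro m n hmn ω ⟨z, hz, hr⟩
    exact ⟨z, fun h => hz (cball_mono _ hmn x h), hr⟩
  have h0 : bernoulliPi w (⋂ n, {ω : Config G | FarExcursion G (openGraph G ω) S n x}) = 0 := by
    refine measure_mono_null (fun ω hω => ?_) (ae_iff.1 hout)
    intro hfin
    have hf : (Subtype.val ⁻¹' comp (outer (openGraph G ω) S) x : Set S).Finite :=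
      (hfin x).preimage Subtype.val_injective.injOn
    obtain ⟨n, hn⟩ := exists_finset_subset_cball (G.induce S) hS x hf.toFinset
    obtain ⟨z, hz, hr⟩ := Set.mem_iInter.1 hω n
    exact hz (hn (hf.mem_toFinset.2 hr))
  have ht := tendsto_measure_iInter_atTop (μ := bernoulliPi w)
    (fun n => (measurableSet_farExcursion G S n x).nullMeasurableSet) hanti
    ⟨0, measure_ne_top _ _⟩
  rw [h0] at ht
  have hev := (ht.eventually (gt_mem_nhds (ENNReal.ofReal_pos.2 hη))).and
    (Filter.eventually_ge_atTop 1)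
  obtain ⟨n, hn, h1⟩ := hev.exists
  exact ⟨n, h1, (ENNReal.lt_ofReal_iff_toReal_lt (measure_ne_top _ _)).1 hn⟩

/-- The Burton–Keane argument: there are no encounter points in `S`. -/
theorem isEncounter_measure_zero {G : SimpleGraph V} [Countable V] {d : ℕ}
    (hd : ∀ v, (G.neighborSet v).Finite ∧ (G.neighborSet v).ncard ≤ d)
    {S : Set V} (hS : (G.induce S).Connected) {Γ : Subgroup (G ≃g G)}
    (hΓ : ActsTransitivelyOn Γ S) (hamen : IsAmenable (G.induce S)) (p q : I)
    (hout : ∀ᵐ ω ∂bernoulliPi (inhomWeight G S p q),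
      ∀ v, (comp (outer (openGraph G ω) S) v).Finite) (R : ℕ) (x : S) :
    bernoulliPi (inhomWeight G S p q) {ω : Config G | IsEncounter G (openGraph G ω) R x} = 0 := by
  classical
  set μ := bernoulliPi (inhomWeight G S p q) with hμ
  by_contra hne
  set δ := μ.real {ω : Config G | IsEncounter G (openGraph G ω) R x} with hδ
  have hδpos : 0 < δ := ENNReal.toReal_pos hne (measure_ne_top _ _)
  set M : ℝ := (d + 1) ^ (R + R) with hM
  have hMpos : 0 < M := by positivity
  -- `M` bounds the size of a `2R`-ball, so a maximal separated `K₀ ⊆ K` has expected encounter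
  -- count at least `|K|δ / M`. Far excursions and boundary points are each allowed `|K|δ / (8M)`,
  -- and twice their sum is only `|K|δ / (2M)`. The factor `N` absorbs thickening the boundary by
  -- `n`.
  obtain ⟨n, hn, hfar⟩ := exists_farExcursion_lt hS _ hout x (η := δ / (8 * M)) (by positivity)
  set N : ℝ := (d + 1) ^ n with hN
  have hNpos : 0 < N := by positivity
  obtain ⟨K, hKne, hK⟩ := hamen (δ / (8 * M * N)) (by positivity)
  have hd' := neighborSet_induce S hd
  set K' : Finset V := K.map (Function.Embedding.subtype _) with hK'
  have hK'S : (K' : Set V) ⊆ S := by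
    intro v hv
    obtain ⟨u, -, rfl⟩ := Finset.mem_map.1 (Finset.mem_coe.1 hv)
    exact u.2
  obtain ⟨K₀, hK₀, hsep, hcov⟩ := exists_separated_subset (G := G) (R + R) K'
  have hcard : (K.card : ℝ) ≤ K₀.card * M := by
    have := card_le_of_cover d (fun v => (hd v).1) (fun v => (hd v).2) (R + R) K' K₀ hcov
    rw [hK', Finset.card_map] at this
    rw [hM]
    exact_mod_cast this
  set D := (K.filter fun y => ¬ cball (G.induce S) n y ⊆ K) with hD
  have hDcard : (D.card : ℝ) ≤ (innerBoundary (G.induce S) (K : Set S)).ncard * N := by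
    have := card_near_boundary_le d (fun v => (hd' v).1) (fun v => (hd' v).2) n K
    rw [hN]
    exact_mod_cast this
  have hsum := sum_measureReal_le μ K₀ K
    (fun v => {ω : Config G | IsEncounter G (openGraph G ω) R v})
    (fun y => {ω : Config G | FarExcursion G (openGraph G ω) S n y})
    (measurableSet_isEncounter G R) (measurableSet_farExcursion G S n) D.card (by
      filter_upwards [hout] with ω hω
      set E := K.filter fun y => FarExcursion G (openGraph G ω) S n y with hE
      refine (card_encounters_le (G := G) (H := openGraph G ω) (K := K')
        (L := (D ∪ E).map (Function.Embedding.subtype _))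
        (fun v => (hd v).1.subset fun u hu => hu.1) hω hK'S ?_
        ((Finset.filter_subset _ _).trans hK₀) (R := R) ?_ ?_).trans ?_
      · intro y hy z hz hzK hexc
        obtain ⟨y, hyK, rfl⟩ := Finset.mem_map.1 hy
        refine Finset.mem_map_of_mem _ (Finset.mem_union.2 ?_)
        have hzK' : (⟨z, hz⟩ : S) ∉ K := fun h => hzK (Finset.mem_map_of_mem _ h)
        by_cases hball : (⟨z, hz⟩ : S) ∈ cball (G.induce S) n y
        · exact Or.inl (Finset.mem_filter.2 ⟨hyK, fun h => hzK' (h hball)⟩)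
        · rcases hexc.outer_reachable with h | h
          -- A direct edge inside `S` stays in the ball of radius one, which is why `n ≥ 1` is
          -- required.
          · exact absurd (cball_mono _ hn y (Or.inr ⟨y, rfl, h.1⟩)) hball
          · exact Or.inr (Finset.mem_filter.2 ⟨hyK, ⟨z, hz⟩, hball, h⟩)
      · intro a ha b hb
        exact hsep a (Finset.mem_filter.1 ha).1 b (Finset.mem_filter.1 hb).1
      · exact fun a ha => (Finset.mem_filter.1 ha).2
      · rw [Finset.card_map]
        exact Nat.mul_le_mul_left 2 (Finset.card_union_le _ _))
  have e1 : ∑ v ∈ K₀, μ.real {ω : Config G | IsEncounter G (openGraph G ω) R v} = K₀.card * δ := by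
    rw [Finset.sum_congr rfl fun v hv => ?_, Finset.sum_const, nsmul_eq_mul]
    rw [hδ, measureReal_def, measureReal_def,
      isEncounter_measure_eq hΓ p q R x.2 (hK'S (hK₀ hv))]
  have e2 : ∑ y ∈ K, μ.real {ω : Config G | FarExcursion G (openGraph G ω) S n y} ≤
      K.card * (δ / (8 * M)) := by
    rw [← nsmul_eq_mul]
    refine Finset.sum_le_card_nsmul _ _ _ fun y _ => ?_
    rw [measureReal_def, hμ, farExcursion_measure_eq hΓ p q n x y]
    exact hfar.le
  rw [e1] at hsum
  have hKpos : (0 : ℝ) < K.card := by exact_mod_cast hKne.card_pos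
  have h1 : K.card * δ ≤ M * (K₀.card * δ) := by nlinarith
  have h2 : (D.card : ℝ) ≤ K.card * (δ / (8 * M)) := by
    refine hDcard.trans ((mul_le_mul_of_nonneg_right hK hNpos.le).trans (le_of_eq ?_))
    field_simp
  have h3 : M * (K₀.card * δ) ≤ M * (4 * (K.card * (δ / (8 * M)))) := by
    exact mul_le_mul_of_nonneg_left (by linarith) hMpos.le
  have h4 : M * (4 * (K.card * (δ / (8 * M)))) = K.card * δ / 2 := by
    field_simp
    norm_num
  have : 0 < K.card * δ := by positivity
  linarith

end Uniqueness

end Percolation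

/-! ### Assembly of the uniqueness theorem. -/

theorem mainTheorem7 {V : Type*} (G : SimpleGraph V) (hG : G.Connected)
    (d : ℕ) (hd : ⨆ v, (G.neighborSet v).encard = (d : ℕ∞))
    (S : Set V) (hS : (G.induce S).Connected)
    (Γ : Subgroup (G ≃g G)) (hΓ : Percolation.ActsTransitivelyOn Γ S)
    (hamen : Percolation.IsAmenable (G.induce S))
    (o : V) (o' : S)
    (hpc_pos : 0 < Percolation.criticalProb (G.induce S) o')
    (hpc_lt : Percolation.criticalProb (G.induce S) o' < 1)
    (p q : unitInterval) (hp_pos : 0 < p) (hp_lt : p < Percolation.criticalProb G o)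
    (hq : max (Percolation.criticalParam G S o (Percolation.invSq d))
      (Percolation.criticalParam G S o p) < q) :
    ∀ᵐ ω ∂(Percolation.inhomPerc G S p q), Percolation.numInfiniteClusters G ω = 1 := by
  open Percolation in
  have hd' := neighborSet_of_iSup_encard hd
  have hfin := fun v => (hd' v).1
  have := countable_of_connected G hG hfin
  have hSinf : S.Infinite := Set.infinite_coe_iff.1 (infinite_of_criticalProb_lt hpc_lt)
  have hq' : criticalParam G S o p < q := (le_max_right _ _).trans_lt hq
  have hq_pos : 0 < q := lt_of_le_of_lt unitInterval.nonneg' hq'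
  rw [inhomPerc_eq]
  have hw := inhomWeight_pos G S hp_pos hq_pos
  have hout := ae_finite_outer_comp hG hfin S hp_pos hp_lt q
  -- Were this probability zero, `q` would belong to the set whose supremum is `q_c(p)`.
  have hperc : bernoulliPi (inhomWeight G S p q) (percolates G o) ≠ 0 := fun h =>
    hq'.not_ge (le_sSup h)
  have hthree : bernoulliPi (inhomWeight G S p q)
      {ω : Config G | HasThreeInfinite (openGraph G ω)} = 0 := by
    by_contra h
    obtain ⟨R, hR⟩ := exists_isEncounter_pos G hG hfin _ hw o' h
    exact hR (isEncounter_measure_zero hd' hS hΓ hamen p q hout R o')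
  have hpos := hasUniqueInfinite_pos G hG hfin _ hw o' fun h => hperc (by
    refine measure_mono_null (fun ω hω => ?_) (measure_union_null h hthree)
    by_cases h3 : HasThreeInfinite (openGraph G ω)
    · exact Or.inr h3
    · exact Or.inl ⟨⟨o, hω⟩, h3⟩)
  have hone := (hasUniqueInfinite_zero_or_one hG hfin hSinf hΓ p q).resolve_left hpos
  have hae := (prob_compl_eq_zero_iff (measurableSet_hasUniqueInfinite G)).2 hone
  filter_upwards [mem_ae_iff.2 hae] with ω hω
  exact numInfiniteClusters_eq_one hω
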